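/- Let $\mathbb P$ be a projective geometry given by axioms: a set of points and a set of lines such that two distinct points lie on a unique line, every line has at least three points, and, if $p,q,r$ are not collinear, $p'\in qr$ and $q'\in pr$, then the lines $pp'$ and $qq'$ meet. The geometry may be non-Desarguesian and its dimension may be infinite; the empty and the one-point geometry are allowed. $\operatorname{Span}$ denotes the span (smallest line-closed set), and $\operatorname{codim} t$ is the least number of points that together with $t$ span $\mathbb P$. Let $\hat N$ be a point basis of $\mathbb P$ (a maximal independent set). For $v\in\hat N$ let $v^*:=\operatorname{Span}(\hat N\setminus v)$ (the node hyperplane of $v$), and for distinct $v,w\in\hat N$ and a point $p\notin\hat N$ on the line $vw$ let $h(p):=\operatorname{Span}((\hat N\setminus\{v,w\})\cup\{p\})$; these are the apical hyperplanes of $\hat N$. Let $\mathcal A$ be any set of apical hyperplanes. For a set $\mathcal H$ of hyperplanes put $\mathcal L(\mathcal H):=\{\bigcap\mathcal S:\mathcal S\subseteq\mathcal H\}$ (with $\bigcap\varnothing=\mathbb P$), and let $\hat N^*:=\{v^*:v\in\hat N\}$. Let $N$ be a set in bijection $v\mapsto\hat v$ with $\hat N$ and $E$ a set in bijection $e\mapsto\mathbf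 h(e)$ with $\mathcal A$. Make a graph $(N,E)$ in which $e$ is a half edge at $v$ if $\mathbf h(e)=\hat v^*$, and a link with endpoints $v,w$ if $\mathbf h(e)=h(p)$ with $p\in \hat v\hat w\setminus\hat N$. For $S\subseteq E$ let $\bigcap\mathbf h(S):=\bigcap_{e\in S}\mathbf h(e)$, and let $N(S)$ be the set of endpoints of the edges of $S$. A circle is the edge set of a simple closed path (of length at least 2). Let $\mathcal B$ be the set of all circles $C$ with $\operatorname{codim}\bigcap\mathbf h(C)<\#C$; call these circles balanced, and write $\Omega(\mathcal A)=(N,E,\mathcal B)$. An edge set is balanced if it contains no half edge and all circles contained in it are balanced. Then: (1) $\Omega(\mathcal A)$ is a biased graph: every edge is a link or a half edge, and no theta graph (union of three internally disjoint paths with the same two endpoints) contains exactly two balanced circles. (2) Let $G(\Omega(\mathcal A))$ be the frame matroid of $\Omega(\mathcal A)$, that is, the finitary matroid on $E$ whose rank function is $\operatorname{rk} S=\#N(S)-b(S)$ for all $S$ with $N(S)$ finite, where $b(S)$ is the number of balanced components of $(N(S),S)$. Let $M(\mathcal A)$ be the finitary matroid on $\mathcal A$ with rank function $\operatorname{rk}\mathcal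 S=\operatorname{codim}\bigcap\mathcal S$. Both matroids exist, and $e\mapsto\mathbf h(e)$ is an isomorphism $G(\Omega(\mathcal A))\cong M(\mathcal A)$. (3) For $t\in\mathcal L(\mathcal A)$ let $\mathbf H(t):=\{e\in E:\mathbf h(e)\supseteq t\}$. Then $\mathbf H(t)$ is a closed set of $G(\Omega(\mathcal A))$ of rank $\operatorname{codim} t$, and $\mathbf H(t)\subseteq\mathbf H(t')$ if and only if $t'\subseteq t$, for all $t,t'\in\mathcal L(\mathcal A)$. The map $\mathbf H$ is a bijection from the flats of finite codimension in $\mathcal L(\mathcal A)$ to the closed sets of finite rank in $G(\Omega(\mathcal A))$. If $\hat N$ is finite, $\mathbf H$ is a bijection from $\mathcal L(\mathcal A)$ to the set of all closed sets of $G(\Omega(\mathcal A))$. (4) Let $S$ be a nonempty connected edge set. If $S$ is unbalanced, then $\bigcap\mathbf h(S)\in\mathcal L(\hat N^*)$. If $N(S)$ is finite (in particular, if $\hat N$ or $S$ is finite), then $S$ is unbalanced if and only if $\bigcap\mathbf h(S)\in\mathcal L(\hat N^*)$. -/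

import Mathlib

open Set

/-! ### Axiomatic projective geometry -/

/-- A projective geometry on the point set `P`, given by its lines.  The empty geometry and the
one-point geometry (both without lines) are allowed, and no bound on the dimension is imposed. -/
structure ProjGeom (P : Type*) where
  /-- The lines, as sets of points. -/
  lines : Set (Set P)
  /-- Two distinct points lie on a unique line. -/
  existsUnique_line : ∀ p q : P, p ≠ q → ∃! l : Set P, l ∈ lines ∧ p ∈ l ∧ q ∈ l
  /-- Every line has at least three points. -/
  three_le : ∀ l ∈ lines, 3 ≤ l.encard
  /-- If `p`, `q`, `r` are not collinear, `p' ∈ qr` and `q' ∈ pr`, then the lines `pp'` and `qq'`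
  meet. -/
  veblen : ∀ p q r p' q' : P, (¬ ∃ l ∈ lines, p ∈ l ∧ q ∈ l ∧ r ∈ l) →
    (∃ l ∈ lines, q ∈ l ∧ r ∈ l ∧ p' ∈ l) → (∃ l ∈ lines, p ∈ l ∧ r ∈ l ∧ q' ∈ l) →
    ∀ l ∈ lines, ∀ m ∈ lines, p ∈ l → p' ∈ l → q ∈ m → q' ∈ m → (l ∩ m).Nonempty

namespace ProjGeom

/-- A subspace (flat) is a line-closed set of points. -/
def IsSubspace {P : Type*} (G : ProjGeom P) (t : Set P) : Prop :=
  ∀ p ∈ t, ∀ q ∈ t, p ≠ q → ∀ l ∈ G.lines, p ∈ l → q ∈ l → l ⊆ t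

/-- The smallest subspace that contains `S`. -/
def span {P : Type*} (G : ProjGeom P) (S : Set P) : Set P :=
  ⋂₀ {t | G.IsSubspace t ∧ S ⊆ t}

/-- A set of points is independent if every proper subset spans a properly smaller subspace. -/
def Indep {P : Type*} (G : ProjGeom P) (S : Set P) : Prop :=
  ∀ T : Set P, T ⊂ S → G.span T ⊂ G.span S

/-- A point basis of the geometry: a maximal independent set of points. -/
def IsBasis {P : Type*} (G : ProjGeom P) (S : Set P) : Prop :=
  Maximal G.Indep S

/-- The codimension of a subspace `t`: the number of points that have to be added to `t` in order
to span the whole geometry (`⊤` if no finite number is enough).  When the dimension is finite this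
is the dimension of the geometry minus that of `t`. -/
noncomputable def codim {P : Type*} (G : ProjGeom P) (t : Set P) : ℕ∞ :=
  ⨅ B ∈ {B : Set P | G.span (t ∪ B) = univ}, B.encard

/-- The point `p` lies on the line through the distinct points `v` and `w`. -/
def OnLine {P : Type*} (G : ProjGeom P) (p v w : P) : Prop :=
  v ≠ w ∧ ∃ l ∈ G.lines, v ∈ l ∧ w ∈ l ∧ p ∈ l

/-- The node hyperplane `v* = Span (N \ v)`, the apical hyperplane with apex `v ∈ N`. -/
def nodeHyp {P : Type*} (G : ProjGeom P) (N : Set P) (v : P) : Set P :=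
  G.span (N \ {v})

/-- The apical hyperplane `Span (N \ {v, w} ∪ {p})`, for an apex `p` on the edge line `vw`,
`p ∉ N`. -/
def linkHyp {P : Type*} (G : ProjGeom P) (N : Set P) (v w p : P) : Set P :=
  G.span ((N \ {v, w}) ∪ {p})

/-- The set of all apical hyperplanes of `N`, with apices in `N` or not. -/
def apicalHyps {P : Type*} (G : ProjGeom P) (N : Set P) : Set (Set P) :=
  {H | (∃ v ∈ N, H = G.nodeHyp N v) ∨
    ∃ v ∈ N, ∃ w ∈ N, ∃ p, G.OnLine p v w ∧ p ∉ N ∧ H = G.linkHyp N v w p}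

end ProjGeom

/-- The set `L(A)` of intersection flats of a set `A` of hyperplanes; it contains the whole point
set, as the empty intersection. -/
def interFlats {P : Type*} (A : Set (Set P)) : Set (Set P) :=
  {t | ∃ S ⊆ A, t = ⋂₀ S}

/-- `M` is the matroid of the set `A` of hyperplanes: the finitary matroid on `A` in which the rank
of `S ⊆ A` is the codimension of its intersection. -/
structure ProjGeom.IsHypMatroid {P : Type*} (G : ProjGeom P) (A : Set (Set P))
    (M : Matroid (Set P)) : Prop where
  ground : M.E = A
  finitary : M.Finitary
  rank : ∀ S ⊆ A, M.eRk S = G.codim (⋂₀ S)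

/-! ### Graphs with links and half edges

A graph with node set `V` and edge set `E` is given by the function `ends` that maps an edge to
its set of endpoints: two for a link, one for a half edge.  Multiple edges are allowed. -/

section Graphs

/-- Every edge is a half edge or a link. -/
def IsLHGraph {V E : Type*} (ends : E → Set V) : Prop :=
  ∀ e, (ends e).encard = 1 ∨ (ends e).encard = 2

/-- `N(S)`, the set of nodes of edges in `S`. -/
def nodesOf {V E : Type*} (ends : E → Set V) (S : Set E) : Set V :=
  ⋃ e ∈ S, ends e

/-- `v` and `w` are in the same component of the spanning subgraph with edge set `S`. -/
def EdgeJoined {V E : Type*} (ends : E → Set V) (S : Set E) : V → V → Prop :=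
  Relation.ReflTransGen (fun v w => ∃ e ∈ S, v ∈ ends e ∧ w ∈ ends e)

/-- The edge set `S` is connected: it is not empty and the graph `(N(S), S)` is connected. -/
def ConnectedEdges {V E : Type*} (ends : E → Set V) (S : Set E) : Prop :=
  S.Nonempty ∧ ∀ v ∈ nodesOf ends S, ∀ w ∈ nodesOf ends S, EdgeJoined ends S v w

/-- `IsGPath ends u w Q X`: there is a path (without repeated nodes) from `u` to `w` whose set of
edges is `Q` and whose set of nodes is `X`. -/
inductive IsGPath {V E : Type*} (ends : E → Set V) : V → V → Set E → Set V → Prop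
  | nil (v : V) : IsGPath ends v v ∅ {v}
  | cons {u v w : V} {e : E} {Q : Set E} {X : Set V} (he : ends e = {u, v}) (hu : u ∉ X)
      (hQ : IsGPath ends v w Q X) : IsGPath ends u w (insert e Q) (insert u X)

/-- A circle: the edge set of a simple closed path.  Its length is at least 2. -/
def IsCircle {V E : Type*} (ends : E → Set V) (C : Set E) : Prop :=
  ∃ (v w : V) (Q : Set E) (X : Set V) (e : E), IsGPath ends v w Q X ∧ v ≠ w ∧
    ends e = {v, w} ∧ e ∉ Q ∧ C = insert e Q

/-- `Q₁`, `Q₂`, `Q₃` are the edge sets of three internally disjoint paths with the same two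
endpoints; their union is a theta graph, whose circles are `Q₁ ∪ Q₂`, `Q₂ ∪ Q₃`, `Q₁ ∪ Q₃`. -/
def IsTheta {V E : Type*} (ends : E → Set V) (Q₁ Q₂ Q₃ : Set E) : Prop :=
  ∃ (v w : V) (X₁ X₂ X₃ : Set V), v ≠ w ∧
    IsGPath ends v w Q₁ X₁ ∧ IsGPath ends v w Q₂ X₂ ∧ IsGPath ends v w Q₃ X₃ ∧
    X₁ ∩ X₂ = {v, w} ∧ X₂ ∩ X₃ = {v, w} ∧ X₁ ∩ X₃ = {v, w} ∧
    Disjoint Q₁ Q₂ ∧ Disjoint Q₂ Q₃ ∧ Disjoint Q₁ Q₃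

/-- `(V, E, ends)` with the class `B` of balanced circles is a biased graph: `B` is a linear class,
that is, no theta graph contains exactly two circles of `B`.  (The three paths of a theta graph may
be listed in any order, so it is enough to forbid one pattern of two.) -/
structure IsBiasedGraph {V E : Type*} (ends : E → Set V) (B : Set (Set E)) : Prop where
  graph : IsLHGraph ends
  circle : ∀ C ∈ B, IsCircle ends C
  linear : ∀ Q₁ Q₂ Q₃ : Set E, IsTheta ends Q₁ Q₂ Q₃ →
    ¬ (Q₁ ∪ Q₂ ∈ B ∧ Q₂ ∪ Q₃ ∈ B ∧ Q₁ ∪ Q₃ ∉ B)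

/-- An edge set is balanced if it has no half edges and all its circles are balanced. -/
def IsBalancedSet {V E : Type*} (ends : E → Set V) (B : Set (Set E)) (S : Set E) : Prop :=
  (∀ e ∈ S, (ends e).encard ≠ 1) ∧ ∀ C ⊆ S, IsCircle ends C → C ∈ B

/-- The node sets of the balanced components of the graph `(N(S), S)`. -/
def balancedComps {V E : Type*} (ends : E → Set V) (B : Set (Set E)) (S : Set E) : Set (Set V) :=
  {W | (∃ v ∈ nodesOf ends S, W = {w | EdgeJoined ends S v w}) ∧
    IsBalancedSet ends B {e ∈ S | ends e ⊆ W}}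

/-- `M` is the frame matroid of the biased graph `(V, E, ends, B)`: the finitary matroid on the edge
set with `rk S = #N(S) - b(N(S), S)` whenever `N(S)` is finite, where `b` is the number of balanced
components.  As this gives the rank of every finite set, there is at most one such matroid. -/
structure IsFrameMatroid {V E : Type*} (ends : E → Set V) (B : Set (Set E))
    (M : Matroid E) : Prop where
  ground : M.E = univ
  finitary : M.Finitary
  rank : ∀ S : Set E, (nodesOf ends S).Finite →
    M.eRk S + (balancedComps ends B S).encard = (nodesOf ends S).encard

end Graphs

/-! ### The biased graph of a Cevian arrangement

`vhat v` is the point of the basis `N` that corresponds to the node `v`, and `h e` is the apical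
hyperplane that corresponds to the edge `e`. -/

/-- The endpoints of the edges: `e` is a half edge at `v` if `h e` is the node hyperplane of `v`,
and a link between `v` and `w` if `h e` has its apex on the edge line `vw` outside `N`. -/
def ProjGeom.cevEnds {P V E : Type*} (G : ProjGeom P) (N : Set P) (vhat : V → P) (h : E → Set P)
    (e : E) : Set V :=
  {v | h e = G.nodeHyp N (vhat v) ∨
    ∃ w p, G.OnLine p (vhat v) (vhat w) ∧ p ∉ N ∧ h e = G.linkHyp N (vhat v) (vhat w) p}

/-- The balanced circles: those whose rank (the codimension of the intersection of the
corresponding hyperplanes) is less than their size. -/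
def ProjGeom.cevBal {P V E : Type*} (G : ProjGeom P) (N : Set P) (vhat : V → P) (h : E → Set P) :
    Set (Set E) :=
  {C | IsCircle (G.cevEnds N vhat h) C ∧ G.codim (⋂ e ∈ C, h e) < C.encard}

/-- The set of edges whose hyperplanes contain `t`. -/
def cevEdges {P E : Type*} (h : E → Set P) (t : Set P) : Set E :=
  {e | t ⊆ h e}

namespace ProjGeom

variable {P : Type*} {G : ProjGeom P}

/-! ### Lines and spans -/

/-! Everything rests on one fact, `codim_inter`: cutting a subspace by a hyperplane that does not
contain it raises the codimension by exactly 1. It follows synthetically from the join theorem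
`mem_span_insert`, so neither coordinates nor finite dimension are needed. It alone makes the
codimension of intersections the rank function of a finitary matroid (`hypMatroid`,
`codim_biInter_eq_eRk`).

An apical hyperplane misses exactly one or two basis points, and these are the endpoints of its
edge. `IsFrame` records these incidences, and the graph theory uses nothing else. Two counts
suffice. A subspace containing all frame points outside `X` has codimension at most `#X`
(`codim_le_encard`), and one that attains a finite bound lies in every hyperplane through those
points (`subset_of_encard_le_codim`). An edge that reaches a new node is independent of the earlier
ones, because the frame point of that node lies on all of them but not on it (`codim_inter_insert`).

Hence a tree has rank equal to its number of edges. In a finite balanced connected set every edge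
outside a spanning tree closes a balanced circle and is redundant, so the rank is one less than the
number of nodes. In an unbalanced connected set a half edge or unbalanced circle forces the
intersection into a node hyperplane; this spreads along links (`inter_subset_node`) until the
intersection is that of all node hyperplanes of the set. Codimensions add over components, which
gives the rank formula. The theta property is a similar count: two balanced circles make two edges
redundant, so a third circle cannot be independent. -/

theorem line_eq {l m : Set P} (hl : l ∈ G.lines) (hm : m ∈ G.lines) {p q : P} (hpq : p ≠ q)
    (hpl : p ∈ l) (hql : q ∈ l) (hpm : p ∈ m) (hqm : q ∈ m) : l = m :=
  (G.existsUnique_line p q hpq).unique ⟨hl, hpl, hql⟩ ⟨hm, hpm, hqm⟩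

theorem exists_line (G : ProjGeom P) {p q : P} (hpq : p ≠ q) : ∃ l ∈ G.lines, p ∈ l ∧ q ∈ l :=
  let ⟨l, hl, _⟩ := G.existsUnique_line p q hpq
  ⟨l, hl⟩

theorem isSubspace_span (S : Set P) : G.IsSubspace (G.span S) := by
  intro p hp q hq hpq l hl hpl hql t ht u hu
  exact hu.1 p (hp u hu) q (hq u hu) hpq l hl hpl hql ht

theorem subset_span (S : Set P) : S ⊆ G.span S := fun _ hx _ ht => ht.2 hx

theorem IsSubspace.span_subset {t S : Set P} (ht : G.IsSubspace t) (h : S ⊆ t) : G.span S ⊆ t :=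
  fun _ hx => hx t ⟨ht, h⟩

theorem span_mono {S T : Set P} (h : S ⊆ T) : G.span S ⊆ G.span T :=
  (isSubspace_span T).span_subset (h.trans (subset_span T))

theorem span_subset_span {S T : Set P} (h : S ⊆ G.span T) : G.span S ⊆ G.span T :=
  (isSubspace_span T).span_subset h

theorem IsSubspace.inter {s t : Set P} (hs : G.IsSubspace s) (ht : G.IsSubspace t) :
    G.IsSubspace (s ∩ t) := fun p hp q hq hpq l hl hpl hql =>
  subset_inter (hs p hp.1 q hq.1 hpq l hl hpl hql) (ht p hp.2 q hq.2 hpq l hl hpl hql)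

theorem isSubspace_univ : G.IsSubspace (univ : Set P) := fun _ _ _ _ _ _ _ _ _ => subset_univ _

theorem isSubspace_biInter {E : Type*} {h : E → Set P} (S : Set E)
    (hS : ∀ e ∈ S, G.IsSubspace (h e)) : G.IsSubspace (⋂ e ∈ S, h e) :=
  fun p hp q hq hpq l hl hpl hql => subset_iInter₂ fun e he =>
    hS e he p (mem_iInter₂.1 hp e he) q (mem_iInter₂.1 hq e he) hpq l hl hpl hql

/-- The step of the join theorem in general position. -/
theorem exists_mem_line_of_mem_line {u : Set P} (hu : G.IsSubspace u) {p x y w a b : P}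
    {l lx ly : Set P} (hl : l ∈ G.lines) (hlx : lx ∈ G.lines) (hly : ly ∈ G.lines)
    (hpl : p ∉ l) (hxy : x ≠ y) (hxl : x ∈ l) (hyl : y ∈ l) (hwl : w ∈ l) (hpu : p ∉ u)
    (hplx : p ∈ lx) (hxlx : x ∈ lx) (halx : a ∈ lx) (ha : a ∈ u)
    (hply : p ∈ ly) (hyly : y ∈ ly) (hbly : b ∈ ly) (hb : b ∈ u) (hax : a ≠ x) :
    ∃ z ∈ u, ∃ m ∈ G.lines, p ∈ m ∧ w ∈ m ∧ z ∈ m := by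
  have hpx : p ≠ x := fun h => hpl (h ▸ hxl)
  have hpy : p ≠ y := fun h => hpl (h ▸ hyl)
  have hpw : p ≠ w := fun h => hpl (h ▸ hwl)
  have hpa : p ≠ a := fun h => hpu (h ▸ ha)
  have hpb : p ≠ b := fun h => hpu (h ▸ hb)
  have hlxy : lx ≠ ly := by
    rintro rfl
    exact hpl (line_eq hlx hl hxy hxlx hyly hxl hyl ▸ hplx)
  have hab : a ≠ b := by
    rintro rfl
    exact hlxy (line_eq hlx hly hpa hplx halx hply hbly)
  obtain ⟨m, hm, ham, hbm⟩ := G.exists_line hab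
  have hmu : m ⊆ u := hu a ha b hb hab m hm ham hbm
  -- In the triangle `x`, `b`, `p`, the line `l` meets the line `m` through `a` and `b`. The point
  -- `s` obtained makes a second use of the axiom possible, which shows that `pw` meets `m`, hence
  -- `u`.
  obtain ⟨s, hsl, hsm⟩ := G.veblen x b p y a
    (by
      rintro ⟨k, hk, hxk, hbk, hpk⟩
      exact hlxy ((line_eq hlx hk hpx hplx hxlx hpk hxk).trans
        (line_eq hk hly hpb hpk hbk hply hbly)))
    ⟨ly, hly, hbly, hply, hyly⟩ ⟨lx, hlx, hxlx, hplx, halx⟩ l hl m hm hxl hyl hbm ham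
  by_cases hwx : w = x
  · subst hwx
    exact ⟨a, ha, lx, hlx, hplx, hxlx, halx⟩
  have hal : a ∉ l := fun hal => hpl (line_eq hlx hl hax halx hxlx hal hxl ▸ hplx)
  obtain ⟨k, hk, hpk, hwk⟩ := G.exists_line hpw
  obtain ⟨z, hzk, hzm⟩ := G.veblen w a x p s
    (by
      rintro ⟨k, hk, hwk, hak, hxk⟩
      exact hal (line_eq hk hl hwx hwk hxk hwl hxl ▸ hak))
    ⟨lx, hlx, halx, hxlx, hplx⟩ ⟨l, hl, hwl, hxl, hsl⟩ k hk m hm hwk hpk ham hsm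
  exact ⟨z, hmu hzm, k, hk, hpk, hwk, hzk⟩

/-- The join theorem: the span of a subspace `u` and a point `p` is the union of the lines that
join `p` to points of `u`. -/
theorem mem_span_insert {u : Set P} (hu : G.IsSubspace u) {p : P} (hp : p ∉ u) {x : P}
    (hx : x ∈ G.span (insert p u)) (hxp : x ≠ p) :
    ∃ z ∈ u, ∃ m ∈ G.lines, p ∈ m ∧ x ∈ m ∧ z ∈ m := by
  suffices h : G.IsSubspace {x | x ≠ p → ∃ z ∈ u, ∃ m ∈ G.lines, p ∈ m ∧ x ∈ m ∧ z ∈ m} by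
    refine h.span_subset (insert_subset (fun h => absurd rfl h) ?_) hx hxp
    intro y hy hyp
    obtain ⟨m, hm, hym, hpm⟩ := G.exists_line hyp
    exact ⟨y, hy, m, hm, hpm, hym, hym⟩
  clear hx hxp x
  intro x hx y hy hxy l hl hxl hyl w hwl hwp
  simp only [mem_ofPred_eq] at hx hy
  by_cases hpl : p ∈ l
  · have key : ∀ x ∈ l, x ≠ p → (x ≠ p → ∃ z ∈ u, ∃ m ∈ G.lines, p ∈ m ∧ x ∈ m ∧ z ∈ m) →
        ∃ z ∈ u, ∃ m ∈ G.lines, p ∈ m ∧ w ∈ m ∧ z ∈ m := by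
      intro x hxl hxp hx
      obtain ⟨z, hz, m, hm, hpm, hxm, hzm⟩ := hx hxp
      exact ⟨z, hz, l, hl, hpl, hwl, line_eq hm hl hxp hxm hpm hxl hpl ▸ hzm⟩
    by_cases hxp : x = p
    · exact key y hyl (fun h => hxy (hxp.trans h.symm)) hy
    · exact key x hxl hxp hx
  obtain ⟨a, ha, lx, hlx, hplx, hxlx, halx⟩ := hx fun h => hpl (h ▸ hxl)
  obtain ⟨b, hb, ly, hly, hply, hyly, hbly⟩ := hy fun h => hpl (h ▸ hyl)
  -- The general step needs one of `x`, `y` to differ from its projection to `u`. Otherwise both lie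
  -- in `u`, and so does `l`.
  by_cases hax : a = x
  · by_cases hby : b = y
    · subst hax hby
      obtain ⟨m, hm, hwm, hpm⟩ := G.exists_line hwp
      exact ⟨w, hu a ha b hb hxy l hl hxl hyl hwl, m, hm, hpm, hwm, hwm⟩
    · exact exists_mem_line_of_mem_line hu hl hly hlx hpl hxy.symm hyl hxl hwl hp hply hyly hbly
        hb hplx hxlx halx ha hby
  · exact exists_mem_line_of_mem_line hu hl hlx hly hpl hxy hxl hyl hwl hp hplx hxlx halx
      ha hply hyly hbly hb hax

/-- A point `x` of the span of `u` and `p` that is not in `u` spans together with `u` the point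
`p`. -/
theorem mem_span_insert_of_mem_span_insert {u : Set P} (hu : G.IsSubspace u) {p x : P}
    (hx : x ∈ G.span (insert p u)) (hxu : x ∉ u) : p ∈ G.span (insert x u) := by
  by_cases hp : p ∈ u
  · exact subset_span _ (mem_insert_of_mem _ hp)
  by_cases hxp : x = p
  · exact hxp ▸ subset_span _ (mem_insert _ _)
  obtain ⟨z, hz, m, hm, hpm, hxm, hzm⟩ := mem_span_insert hu hp hx hxp
  exact isSubspace_span _ x (subset_span _ (mem_insert _ _)) z
    (subset_span _ (mem_insert_of_mem _ hz)) (fun h => hxu (h ▸ hz)) m hm hxm hzm hpm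

/-! ### Hyperplanes -/

/-- A hyperplane: a proper subspace that meets every line. -/
structure IsHyperplane (G : ProjGeom P) (H : Set P) : Prop where
  isSubspace : G.IsSubspace H
  ne_univ : H ≠ univ
  meets : ∀ l ∈ G.lines, (l ∩ H).Nonempty

/-- By exchange, any point `x` outside `H` completes `H` just as `q` does; the join theorem from `x`
then puts a point of `H` on each line through `x`. -/
theorem IsSubspace.isHyperplane {H : Set P} (hH : G.IsSubspace H) {q : P} (hq : q ∉ H)
    (h : G.span (insert q H) = univ) : G.IsHyperplane H where
  isSubspace := hH
  ne_univ := fun h => hq (h ▸ mem_univ q)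
  meets l hl := by
    obtain ⟨x, hx, y, hy, hxy⟩ : ∃ x ∈ l, ∃ y ∈ l, x ≠ y :=
      one_lt_encard_iff_nontrivial.1 (lt_of_lt_of_le (by norm_num) (G.three_le l hl))
    by_cases hxH : x ∈ H
    · exact ⟨x, hx, hxH⟩
    have hx' : G.span (insert x H) = univ := by
      refine eq_univ_of_univ_subset (h ▸ span_subset_span (insert_subset ?_ ?_))
      · exact mem_span_insert_of_mem_span_insert hH (h ▸ mem_univ x) hxH
      · exact (subset_insert _ _).trans (subset_span _)
    obtain ⟨z, hz, m, hm, hxm, hym, hzm⟩ :=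
      mem_span_insert hH hxH (x := y) (hx' ▸ mem_univ y) hxy.symm
    exact ⟨z, line_eq hm hl hxy hxm hym hx hy ▸ hzm, hz⟩

/-- A hyperplane and a point `p` outside span everything; more precisely, if `p` and `x` are in the
subspace `t`, then `x` is in the span of `t ∩ H` and `p`. -/
theorem IsHyperplane.mem_of_mem {H : Set P} (hH : G.IsHyperplane H) {t : Set P}
    (ht : G.IsSubspace t) {p x : P} (hp : p ∈ t) (hpH : p ∉ H) (hx : x ∈ t) {u : Set P}
    (hu : G.IsSubspace u) (hpu : p ∈ u) (htu : t ∩ H ⊆ u) : x ∈ u := by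
  by_cases hxp : x = p
  · exact hxp ▸ hpu
  obtain ⟨l, hl, hxl, hpl⟩ := G.exists_line hxp
  obtain ⟨z, hzl, hzH⟩ := hH.meets l hl
  have hz : z ∈ t := ht x hx p hp hxp l hl hxl hpl hzl
  exact hu z (htu ⟨hz, hzH⟩) p hpu (fun h => hpH (h ▸ hzH)) l hl hzl hpl hxl

/-! ### Codimension -/

theorem codim_le {t B : Set P} (h : G.span (t ∪ B) = univ) : G.codim t ≤ B.encard :=
  iInf₂_le B h

theorem le_codim {t : Set P} {n : ℕ∞} (h : ∀ B, G.span (t ∪ B) = univ → n ≤ B.encard) :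
    n ≤ G.codim t :=
  le_iInf₂ h

theorem exists_encard_eq_codim (G : ProjGeom P) (t : Set P) :
    ∃ B, G.span (t ∪ B) = univ ∧ B.encard = G.codim t := by
  have hne : {n | ∃ B, G.span (t ∪ B) = univ ∧ B.encard = n}.Nonempty :=
    ⟨_, univ, eq_univ_of_univ_subset (subset_union_right.trans (subset_span _)), rfl⟩
  obtain ⟨B, hB, hBn⟩ := csInf_mem hne
  refine ⟨B, hB, le_antisymm (le_codim fun C hC => ?_) (codim_le hB)⟩
  exact hBn.le.trans (csInf_le' ⟨C, hC, rfl⟩)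

theorem codim_anti {s t : Set P} (h : s ⊆ t) : G.codim t ≤ G.codim s :=
  le_codim fun B hB => codim_le (eq_univ_of_univ_subset
    (hB ▸ span_mono (union_subset_union_left B h)))

theorem codim_univ (G : ProjGeom P) : G.codim univ = 0 := by
  refine le_antisymm ?_ zero_le
  exact (codim_le (B := ∅) (eq_univ_of_univ_subset
    (subset_union_left.trans (subset_span _)))).trans encard_empty.le

theorem codim_inter_le {t H : Set P} (ht : G.IsSubspace t) (hH : G.IsHyperplane H) :
    G.codim (t ∩ H) ≤ G.codim t + 1 := by
  obtain ⟨B, hB, hBt⟩ := G.exists_encard_eq_codim t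
  by_cases h : t ⊆ H
  · rw [inter_eq_left.2 h]
    exact le_self_add
  obtain ⟨p, hp, hpH⟩ := not_subset.1 h
  rw [← hBt]
  refine (codim_le (B := insert p B) (eq_univ_of_univ_subset (hB ▸ span_subset_span ?_))).trans
    (encard_insert_le B p)
  refine union_subset (fun x hx => ?_) fun x hx => subset_span _ (by simp [hx])
  exact hH.mem_of_mem ht hp hpH hx (isSubspace_span _) (subset_span _ (by simp))
    (subset_union_left.trans (subset_span _))

/-- For the lower bound, a set `B` completing `t ∩ H` has a point `b` outside `H`. Projecting the
rest of `B` from `b` into `H` gives a set that completes `t`, with one point saved. -/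
theorem codim_inter {t H : Set P} (ht : G.IsSubspace t) (hH : G.IsHyperplane H) (h : ¬ t ⊆ H) :
    G.codim (t ∩ H) = G.codim t + 1 := by
  refine le_antisymm (codim_inter_le ht hH) (le_codim fun B hB => ?_)
  obtain ⟨q, hq, hqH⟩ := not_subset.1 h
  obtain ⟨b, hb, hbH⟩ : ∃ b ∈ B, b ∉ H := by
    by_contra! hBH
    refine hH.ne_univ (eq_univ_of_univ_subset (hB ▸ hH.isSubspace.span_subset ?_))
    exact union_subset inter_subset_right hBH
  have hproj : ∀ x, ∃ y, x ≠ b → y ∈ H ∧ ∃ l ∈ G.lines, b ∈ l ∧ x ∈ l ∧ y ∈ l := by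
    intro x
    by_cases hxb : x = b
    · exact ⟨x, fun h => absurd hxb h⟩
    · obtain ⟨l, hl, hxl, hbl⟩ := G.exists_line hxb
      obtain ⟨y, hyl, hyH⟩ := hH.meets l hl
      exact ⟨y, fun _ => ⟨hyH, l, hl, hbl, hxl, hyl⟩⟩
  choose f hf using hproj
  set K := G.span ((t ∩ H) ∪ f '' (B \ {b})) with hK
  have hKs : G.IsSubspace K := isSubspace_span _
  have hKH : K ⊆ H := hH.isSubspace.span_subset (union_subset inter_subset_right (by
    rintro _ ⟨x, hx, rfl⟩
    exact (hf x hx.2).1))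
  have hbK : b ∉ K := fun h => hbH (hKH h)
  have hKb : G.span (insert b K) = univ := by
    refine eq_univ_of_univ_subset (hB ▸ span_subset_span (union_subset ?_ fun x hx => ?_))
    · exact fun x hx => subset_span _ (mem_insert_of_mem _ (subset_span _ (Or.inl hx)))
    · by_cases hxb : x = b
      · exact subset_span _ (by simp [hxb])
      obtain ⟨hyH, l, hl, hbl, hxl, hyl⟩ := hf x hxb
      exact isSubspace_span _ b (subset_span _ (mem_insert _ _)) (f x)
        (subset_span _ (mem_insert_of_mem _
          (subset_span _ (Or.inr (mem_image_of_mem f (mem_sdiff_singleton.2 ⟨hx, hxb⟩))))))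
        (fun h => hbH (h ▸ hyH)) l hl hbl hyl hxl
  -- The line from `b` to a point of `H` meets `K ⊆ H`; being outside `H`, `b` forces the two points
  -- to coincide.
  have hHK : H ⊆ K := by
    intro x hx
    obtain ⟨z, hz, m, hm, hbm, hxm, hzm⟩ := mem_span_insert hKs hbK (x := x) (hKb ▸ mem_univ x)
      fun h => hbH (h ▸ hx)
    by_cases hxz : x = z
    · exact hxz ▸ hz
    · exact absurd (hH.isSubspace x hx z (hKH hz) hxz m hm hxm hzm hbm) hbH
  rw [← encard_sdiff_singleton_add_one hb]
  gcongr
  refine (codim_le (eq_univ_of_forall fun x => ?_)).trans (encard_image_le f _)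
  refine hH.mem_of_mem isSubspace_univ (mem_univ q) hqH (mem_univ x) (isSubspace_span _)
    (subset_span _ (Or.inl hq)) ?_
  rw [univ_inter]
  exact hHK.trans (span_mono (union_subset_union_left _ inter_subset_left))

/-! ### Bases and apical hyperplanes -/

theorem Indep.notMem_span {N : Set P} (hN : G.Indep N) {v : P} (hv : v ∈ N) :
    v ∉ G.span (N \ {v}) := by
  intro h
  refine (hN (N \ {v}) (sdiff_singleton_ssubset.2 hv)).2 (span_subset_span fun x hx => ?_)
  by_cases hxv : x = v
  · exact hxv ▸ h
  · exact subset_span _ ⟨hx, hxv⟩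

theorem indep_of_notMem_span {N : Set P} (h : ∀ v ∈ N, v ∉ G.span (N \ {v})) : G.Indep N := by
  intro T hT
  obtain ⟨v, hv, hvT⟩ := exists_of_ssubset hT
  refine ⟨span_mono hT.1, fun hle => h v hv ?_⟩
  exact span_mono (subset_sdiff_singleton hT.1 hvT) (hle (subset_span _ hv))

/-- A point `p` outside the span could be added to `N`: a dependence of some `v ∈ N` on `p` and the
rest could be exchanged into one of `p` on `N`. -/
theorem IsBasis.span_eq {N : Set P} (hN : G.IsBasis N) : G.span N = univ := by
  refine eq_univ_of_forall fun p => by_contra fun hp => ?_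
  have hpN : p ∉ N := fun h => hp (subset_span _ h)
  suffices h : G.Indep (insert p N) from
    hpN (hN.2 h (subset_insert _ _) (mem_insert _ _))
  refine indep_of_notMem_span fun v hv hmem => ?_
  rcases hv with rfl | hv
  · exact hp (span_mono (by simp) hmem)
  have hvs := hN.1.notMem_span hv
  have hmem' : v ∈ G.span (insert p (G.span (N \ {v}))) := by
    refine span_mono ?_ hmem
    rintro x ⟨rfl | hx, hxv⟩
    · exact mem_insert _ _
    · exact mem_insert_of_mem _ (subset_span _ ⟨hx, hxv⟩)
  refine hp (span_subset_span (insert_subset (subset_span _ hv) ?_)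
    (mem_span_insert_of_mem_span_insert (isSubspace_span _) hmem' hvs))
  exact span_mono sdiff_subset

theorem IsBasis.notMem_nodeHyp {N : Set P} (hN : G.IsBasis N) {v : P} (hv : v ∈ N) :
    v ∉ G.nodeHyp N v :=
  hN.1.notMem_span hv

theorem IsBasis.mem_nodeHyp_iff {N : Set P} (hN : G.IsBasis N) {v w : P} (hw : w ∈ N) :
    w ∈ G.nodeHyp N v ↔ w ≠ v :=
  ⟨fun h hwv => hN.notMem_nodeHyp hw (hwv.symm ▸ h), fun h => subset_span _ ⟨hw, h⟩⟩

theorem IsBasis.isHyperplane_nodeHyp {N : Set P} (hN : G.IsBasis N) {v : P} (hv : v ∈ N) :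
    G.IsHyperplane (G.nodeHyp N v) := by
  refine (isSubspace_span _).isHyperplane (hN.notMem_nodeHyp hv)
    (eq_univ_of_univ_subset (hN.span_eq ▸ span_mono fun x hx => ?_))
  by_cases hxv : x = v
  · exact hxv ▸ mem_insert _ _
  · exact mem_insert_of_mem _ (subset_span _ ⟨hx, hxv⟩)

theorem OnLine.symm {p v w : P} (h : G.OnLine p v w) : G.OnLine p w v :=
  let ⟨hvw, l, hl, hvl, hwl, hpl⟩ := h
  ⟨hvw.symm, l, hl, hwl, hvl, hpl⟩

theorem linkHyp_comm (N : Set P) (v w p : P) : G.linkHyp N v w p = G.linkHyp N w v p := by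
  rw [linkHyp, linkHyp, pair_comm]

/-- Otherwise the join theorem puts a point `z` of `Span (N \ {v, w})` on the line `vw`. Then `w`
and `z` are distinct points of `v*` on that line, so `v ∈ v*`. -/
theorem IsBasis.notMem_linkHyp {N : Set P} (hN : G.IsBasis N) {v w p : P} (hv : v ∈ N)
    (hw : w ∈ N) (hp : G.OnLine p v w) (hpN : p ∉ N) : v ∉ G.linkHyp N v w p := by
  obtain ⟨hvw, l, hl, hvl, hwl, hpl⟩ := hp
  intro hmem
  have hvp : v ≠ p := fun h => hpN (h ▸ hv)
  have huv : G.span (N \ {v, w}) ⊆ G.nodeHyp N v :=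
    span_mono (sdiff_subset_sdiff_right (by simp))
  have huw : G.span (N \ {v, w}) ⊆ G.nodeHyp N w :=
    span_mono (sdiff_subset_sdiff_right (by simp))
  have hus : G.IsSubspace (G.span (N \ {v, w})) := isSubspace_span _
  have hvu : v ∉ G.span (N \ {v, w}) := fun h => hN.notMem_nodeHyp hv (huv h)
  have hle : G.linkHyp N v w p ⊆ G.span (insert p (G.span (N \ {v, w}))) :=
    span_mono (union_subset ((subset_span _).trans (subset_insert _ _)) (by simp))
  have hpu : p ∉ G.span (N \ {v, w}) := fun h => hvu
    (hus.span_subset (insert_subset h subset_rfl) (hle hmem))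
  obtain ⟨z, hz, m, hm, hpm, hvm, hzm⟩ := mem_span_insert hus hpu (hle hmem) hvp
  have hml := line_eq hm hl hvp hvm hpm hvl hpl
  subst hml
  exact hN.notMem_nodeHyp hv (isSubspace_span _ w ((hN.mem_nodeHyp_iff hw).2 hvw.symm) z (huv hz)
    (fun h => hN.notMem_nodeHyp hw (huw (h ▸ hz))) m hm hwl hzm hvm)

theorem IsBasis.mem_linkHyp_iff {N : Set P} (hN : G.IsBasis N) {v w p x : P} (hv : v ∈ N)
    (hw : w ∈ N) (hp : G.OnLine p v w) (hpN : p ∉ N) (hx : x ∈ N) :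
    x ∈ G.linkHyp N v w p ↔ x ≠ v ∧ x ≠ w := by
  refine ⟨fun h => ⟨?_, ?_⟩, fun h => subset_span _ (Or.inl ⟨hx, by simp [h]⟩)⟩
  · rintro rfl
    exact hN.notMem_linkHyp hv hw hp hpN h
  · rintro rfl
    exact hN.notMem_linkHyp hw hv hp.symm hpN (linkHyp_comm N v x p ▸ h)

theorem IsBasis.isHyperplane_linkHyp {N : Set P} (hN : G.IsBasis N) {v w p : P} (hv : v ∈ N)
    (hw : w ∈ N) (hp : G.OnLine p v w) (hpN : p ∉ N) :
    G.IsHyperplane (G.linkHyp N v w p) := by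
  refine (isSubspace_span _).isHyperplane (hN.notMem_linkHyp hv hw hp hpN)
    (eq_univ_of_univ_subset (hN.span_eq ▸ span_subset_span fun x hx => ?_))
  by_cases hxv : x = v
  · exact hxv ▸ subset_span _ (mem_insert _ _)
  by_cases hxw : x = w
  · obtain ⟨-, l, hl, hvl, hwl, hpl⟩ := hp
    exact isSubspace_span _ v (subset_span _ (mem_insert _ _)) p
      (subset_span _ (mem_insert_of_mem _ (subset_span _ (Or.inr rfl))))
      (fun h => hpN (h ▸ hv)) l hl hvl hpl (hxw ▸ hwl)
  · exact subset_span _ (mem_insert_of_mem _ (subset_span _ (Or.inl ⟨hx, by simp [hxv, hxw]⟩)))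

end ProjGeom

namespace ProjGeom

variable {P E : Type*} {G : ProjGeom P} {h : E → Set P}

/-! ### The matroid of a family of hyperplanes -/

theorem isSubspace_biInter_hyperplanes (hh : ∀ e, G.IsHyperplane (h e)) (S : Set E) :
    G.IsSubspace (⋂ e ∈ S, h e) :=
  isSubspace_biInter S fun e _ => (hh e).isSubspace

theorem biInter_anti {S T : Set E} (hST : S ⊆ T) : (⋂ e ∈ T, h e) ⊆ ⋂ e ∈ S, h e :=
  biInter_subset_biInter_left hST

theorem codim_inter_biInter_le (hh : ∀ e, G.IsHyperplane (h e)) {t : Set P}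
    (ht : G.IsSubspace t) (S : Set E) :
    G.codim (t ∩ ⋂ e ∈ S, h e) ≤ G.codim t + S.encard := by
  obtain hS | hS := S.finite_or_infinite
  · induction S, hS using Set.Finite.induction_on with
    | empty => simp
    | @insert a s ha hs ih =>
      rw [biInter_insert, inter_comm (h a), ← inter_assoc, encard_insert_of_notMem ha, ← add_assoc]
      refine (codim_inter_le (ht.inter (isSubspace_biInter_hyperplanes hh s)) (hh a)).trans ?_
      gcongr
  · simp [hS.encard_eq]

theorem codim_biInter_le (hh : ∀ e, G.IsHyperplane (h e)) (S : Set E) :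
    G.codim (⋂ e ∈ S, h e) ≤ S.encard := by
  simpa [codim_univ] using codim_inter_biInter_le hh (G := G) isSubspace_univ S

/-- The members of `T \ S` raise the codimension by at most 1 each, so a deficit of `S` could not be
made up. -/
theorem codim_biInter_eq_of_subset (hh : ∀ e, G.IsHyperplane (h e)) {S T : Set E} (hST : S ⊆ T)
    (hT : T.Finite) (h' : G.codim (⋂ e ∈ T, h e) = T.encard) :
    G.codim (⋂ e ∈ S, h e) = S.encard := by
  refine le_antisymm (codim_biInter_le hh S) ?_
  have h1 := codim_inter_biInter_le hh (isSubspace_biInter_hyperplanes hh S) (T \ S)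
  rw [← biInter_union, union_sdiff_cancel hST, h', ← encard_sdiff_add_encard_of_subset hST,
    add_comm] at h1
  exact (WithTop.add_le_add_iff_right (hT.subset sdiff_subset).encard_lt_top.ne).1 h1

theorem codim_biInter_insert (hh : ∀ e, G.IsHyperplane (h e)) {S : Set E} {e : E}
    (he : ¬ (⋂ e ∈ S, h e) ⊆ h e) :
    G.codim (⋂ f ∈ insert e S, h f) = G.codim (⋂ e ∈ S, h e) + 1 := by
  rw [biInter_insert, inter_comm]
  exact codim_inter (isSubspace_biInter_hyperplanes hh S) (hh e) he

/-- A set of hyperplanes of a family is independent if the intersection of any `n` of them has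
codimension `n`. -/
def HypIndep (G : ProjGeom P) (h : E → Set P) (I : Set E) : Prop :=
  ∀ J ⊆ I, J.Finite → G.codim (⋂ e ∈ J, h e) = J.encard

theorem hypIndep_iff_of_finite (hh : ∀ e, G.IsHyperplane (h e)) {I : Set E} (hI : I.Finite) :
    G.HypIndep h I ↔ G.codim (⋂ e ∈ I, h e) = I.encard :=
  ⟨fun hi => hi I subset_rfl hI, fun hi _ hJ _ => codim_biInter_eq_of_subset hh hJ hI hi⟩

theorem HypIndep.insert_of_not_subset (hh : ∀ e, G.IsHyperplane (h e)) {I : Set E}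
    (hI : G.HypIndep h I) (hfin : I.Finite) {e : E} (he : ¬ (⋂ e ∈ I, h e) ⊆ h e) : G.HypIndep h (insert e I) := by
  have heI : e ∉ I := fun heI => he (biInter_subset_of_mem heI)
  rw [hypIndep_iff_of_finite hh (hfin.insert e), codim_biInter_insert hh he,
    encard_insert_of_notMem heI, hI I subset_rfl hfin]

/-- The finitary matroid on the index set of a family of hyperplanes in which the rank of a set is
the codimension of the intersection. -/
def hypIndepMatroid (G : ProjGeom P) (h : E → Set P) (hh : ∀ e, G.IsHyperplane (h e)) :
    IndepMatroid E :=
  IndepMatroid.ofFinitaryCardAugment univ (G.HypIndep h)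
    (fun J hJ _ => by simp [subset_empty_iff.1 hJ, codim_univ])
    (fun I J hJ hIJ K hK => hJ K (hK.trans hIJ))
    -- If no member of `J` augments `I`, every hyperplane of `J` contains the intersection over `I`,
    -- so the codimension for `J` is no larger and `J` is not the bigger set.
    (fun I J hI hIf hJ hJf hlt => by
      by_contra! hcon
      refine hlt.not_ge ?_
      have hsub : (⋂ e ∈ I, h e) ⊆ ⋂ e ∈ J, h e := subset_iInter₂ fun e he => by
        by_contra hne
        exact hcon e he (fun heI => hne (biInter_subset_of_mem heI))
          (hI.insert_of_not_subset hh hIf hne)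
      have := codim_anti (G := G) hsub
      rw [hI I subset_rfl hIf, hJ J subset_rfl hJf] at this
      rwa [← hIf.cast_ncard_eq, ← hJf.cast_ncard_eq, Nat.cast_le] at this)
    (fun I hI J hJ hJf => hI J hJ hJf J subset_rfl hJf)
    (fun _ _ => subset_univ _)

/-- The matroid of a family of hyperplanes. -/
def hypMatroid (G : ProjGeom P) (h : E → Set P) (hh : ∀ e, G.IsHyperplane (h e)) : Matroid E :=
  (hypIndepMatroid G h hh).matroid

section

variable (hh : ∀ e, G.IsHyperplane (h e))

theorem hypMatroid_ground : (G.hypMatroid h hh).E = univ := rfl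

instance hypMatroid_finitary : (G.hypMatroid h hh).Finitary :=
  IndepMatroid.ofFinitaryCardAugment_finitary ..

/-- A finite basis of `S` has the same intersection as `S`, since a hyperplane not containing it
would extend the basis. An infinite one has finite subsets of arbitrarily large codimension. -/
theorem codim_biInter_eq_eRk (S : Set E) :
    (G.hypMatroid h hh).eRk S = G.codim (⋂ e ∈ S, h e) := by
  obtain ⟨I, hI⟩ := (G.hypMatroid h hh).exists_isBasis S (subset_univ _)
  rw [← hI.encard_eq_eRk]
  have hIi : G.HypIndep h I := hI.indep
  obtain hf | hf := I.finite_or_infinite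
  · rw [← hIi I subset_rfl hf]
    refine congrArg _ (Subset.antisymm (subset_iInter₂ fun e he => ?_) (biInter_anti hI.subset))
    by_contra hne
    exact hne (biInter_subset_of_mem (hI.mem_of_insert_indep he
      (hIi.insert_of_not_subset hh hf hne)))
  · rw [hf.encard_eq]
    refine (ENat.eq_top_iff_forall_ge.2 fun n => ?_).symm
    obtain ⟨J, hJI, hJf, hJ⟩ := hf.exists_subset_ncard_eq n
    rw [← hJ, hJf.cast_ncard_eq, ← hIi J hJI hJf]
    exact codim_anti (biInter_anti (hJI.trans hI.subset))

/-- Adding `e` leaves the rank unchanged. This is informative only for finite rank, hence the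
restriction to finite codimension in the bijection. The converse below needs none, as closure is
determined by finite subsets. -/
theorem mem_closure_of_biInter_subset {S : Set E} {e : E} (hS : G.codim (⋂ f ∈ S, h f) < ⊤)
    (he : (⋂ f ∈ S, h f) ⊆ h e) : e ∈ (G.hypMatroid h hh).closure S := by
  by_contra hne
  have h1 := Matroid.eRk_insert_eq_add_one (M := G.hypMatroid h hh) (X := S) ⟨mem_univ e, hne⟩
  rw [codim_biInter_eq_eRk, codim_biInter_eq_eRk, biInter_insert, inter_eq_right.2 he] at h1
  exact (ENat.lt_add_one_iff hS.ne).2 le_rfl |>.ne h1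

theorem biInter_subset_of_mem_closure {S : Set E} {e : E}
    (he : e ∈ (G.hypMatroid h hh).closure S) : (⋂ f ∈ S, h f) ⊆ h e := by
  obtain ⟨I, hIS, hIf, -, heI⟩ := Matroid.exists_mem_finite_closure_of_mem_closure he
  refine (biInter_anti hIS).trans ?_
  by_contra hne
  have h1 := codim_biInter_insert hh hne
  have h2 : G.codim (⋂ f ∈ I, h f) < ⊤ := (codim_biInter_le hh I).trans_lt hIf.encard_lt_top
  rw [← codim_biInter_eq_eRk hh, ← codim_biInter_eq_eRk hh, ← Matroid.eRk_closure_eq,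
    Matroid.closure_insert_eq_of_mem_closure heI, Matroid.eRk_closure_eq,
    codim_biInter_eq_eRk hh] at h1
  exact (ENat.lt_add_one_iff h2.ne).2 le_rfl |>.ne h1

/-- The matroid of a set of hyperplanes. -/
theorem isHypMatroid_map (hinj : Function.Injective h) :
    G.IsHypMatroid (range h) ((G.hypMatroid h hh).map h hinj.injOn) where
  ground := by simp [hypMatroid_ground]
  finitary := inferInstance
  rank S hS := by
    obtain ⟨T, rfl⟩ := subset_range_iff_exists_image_eq.1 hS
    rw [Matroid.eRk_map _ _ (subset_univ T), codim_biInter_eq_eRk, sInter_image]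

/-! ### Intersection flats and closed sets -/

theorem biInter_cevEdges {t : Set P} (ht : t ∈ interFlats (range h)) :
    (⋂ e ∈ cevEdges h t, h e) = t := by
  obtain ⟨S, hS, rfl⟩ := ht
  refine Subset.antisymm (fun x hx H hH => ?_) (subset_iInter₂ fun e he => he)
  obtain ⟨e, rfl⟩ := hS hH
  exact mem_iInter₂.1 hx e (sInter_subset_of_mem hH)

theorem biInter_mem_interFlats (S : Set E) : (⋂ e ∈ S, h e) ∈ interFlats (range h) :=
  ⟨h '' S, image_subset_range h S, sInter_image h S |>.symm⟩

theorem cevEdges_subset_iff {t t' : Set P} (ht : t ∈ interFlats (range h)) :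
    cevEdges h t ⊆ cevEdges h t' ↔ t' ⊆ t := by
  refine ⟨fun hsub => ?_, fun hsub e he => hsub.trans he⟩
  rw [← biInter_cevEdges ht]
  exact subset_iInter₂ fun e he => hsub he

theorem eRk_cevEdges {t : Set P} (ht : t ∈ interFlats (range h)) :
    (G.hypMatroid h hh).eRk (cevEdges h t) = G.codim t := by
  rw [codim_biInter_eq_eRk, biInter_cevEdges ht]

theorem isFlat_cevEdges {t : Set P} (ht : t ∈ interFlats (range h)) :
    (G.hypMatroid h hh).IsFlat (cevEdges h t) := by
  rw [Matroid.isFlat_iff_closure_eq]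
  refine Subset.antisymm (fun e he => ?_) (Matroid.subset_closure _ _ (subset_univ _))
  have := biInter_subset_of_mem_closure hh he
  rwa [biInter_cevEdges ht] at this

theorem cevEdges_biInter {F : Set E} (hF : (G.hypMatroid h hh).IsFlat F)
    (hr : (G.hypMatroid h hh).eRk F < ⊤) : cevEdges h (⋂ e ∈ F, h e) = F := by
  refine Subset.antisymm (fun e he => ?_) fun e he => biInter_subset_of_mem he
  rw [← hF.closure]
  exact mem_closure_of_biInter_subset hh (codim_biInter_eq_eRk hh F ▸ hr) he

theorem bijOn_cevEdges : BijOn (cevEdges h) {t ∈ interFlats (range h) | G.codim t < ⊤}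
    {F | (G.hypMatroid h hh).IsFlat F ∧ (G.hypMatroid h hh).eRk F < ⊤} := by
  refine ⟨fun t ht => ⟨isFlat_cevEdges hh ht.1, (eRk_cevEdges hh ht.1).trans_lt ht.2⟩,
    fun t ht t' ht' heq => ?_, fun F hF => ⟨⋂ e ∈ F, h e, ⟨biInter_mem_interFlats F, ?_⟩,
      cevEdges_biInter hh hF.1 hF.2⟩⟩
  · exact Subset.antisymm ((cevEdges_subset_iff ht'.1).1 heq.symm.subset)
      ((cevEdges_subset_iff ht.1).1 heq.subset)
  · exact codim_biInter_eq_eRk hh F ▸ hF.2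

theorem bijOn_cevEdges_of_finite {N : Set P} (hN : G.span N = univ) (hf : N.Finite) :
    BijOn (cevEdges h) (interFlats (range h)) {F | (G.hypMatroid h hh).IsFlat F} := by
  have hcodim : ∀ t, G.codim t < ⊤ := fun t => (codim_le (eq_univ_of_univ_subset
    (hN ▸ span_mono subset_union_right))).trans_lt hf.encard_lt_top
  simpa [codim_biInter_eq_eRk, hcodim] using bijOn_cevEdges hh

end

end ProjGeom

/-! ### Paths, circles and components -/

section GraphLemmas

variable {V E : Type*} {ends : E → Set V}

theorem mem_nodesOf {S : Set E} {v : V} : v ∈ nodesOf ends S ↔ ∃ e ∈ S, v ∈ ends e := by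
  simp [nodesOf]

theorem ends_subset_nodesOf {S : Set E} {e : E} (he : e ∈ S) : ends e ⊆ nodesOf ends S :=
  fun _ hv => mem_nodesOf.2 ⟨e, he, hv⟩

theorem IsLHGraph.nonempty (hG : IsLHGraph ends) (e : E) : (ends e).Nonempty := by
  rw [← encard_pos]
  rcases hG e with h | h <;> simp [h]

theorem IsLHGraph.finite (hG : IsLHGraph ends) (e : E) : (ends e).Finite := by
  rcases hG e with h | h
  · exact finite_of_encard_eq_coe (k := 1) h
  · exact finite_of_encard_eq_coe (k := 2) h

theorem IsLHGraph.eq_pair (hG : IsLHGraph ends) {e : E} {v w : V} (hv : v ∈ ends e)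
    (hw : w ∈ ends e) (hvw : v ≠ w) : ends e = {v, w} := by
  refine ((hG.finite e).eq_of_subset_of_encard_le' (pair_subset hv hw) ?_).symm
  rw [encard_pair hvw]
  rcases hG e with h | h <;> simp [h]

namespace IsGPath

theorem left_mem {u w : V} {Q : Set E} {X : Set V} (h : IsGPath ends u w Q X) : u ∈ X := by
  cases h <;> simp

theorem right_mem {u w : V} {Q : Set E} {X : Set V} (h : IsGPath ends u w Q X) : w ∈ X := by
  induction h with
  | nil => simp
  | cons _ _ _ ih => exact mem_insert_of_mem _ ih

theorem ends_subset {u w : V} {Q : Set E} {X : Set V} (h : IsGPath ends u w Q X) :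
    ∀ e ∈ Q, ends e ⊆ X := by
  induction h with
  | nil => simp
  | cons he hu hQ ih =>
    rintro f (rfl | hf)
    · exact he.subset.trans (insert_subset_insert (singleton_subset_iff.2 hQ.left_mem))
    · exact (ih f hf).trans (subset_insert _ _)

theorem finite {u w : V} {Q : Set E} {X : Set V} (h : IsGPath ends u w Q X) : Q.Finite := by
  induction h with
  | nil => simp
  | cons _ _ _ ih => exact ih.insert _

theorem notMem_edges {u v w : V} {e : E} {Q : Set E} {X : Set V} (h : IsGPath ends v w Q X)
    (he : ends e = {u, v}) (hu : u ∉ X) : e ∉ Q :=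
  fun heQ => hu (h.ends_subset e heQ (by simp [he]))

theorem encard_add_one {u w : V} {Q : Set E} {X : Set V} (h : IsGPath ends u w Q X) :
    Q.encard + 1 = X.encard := by
  induction h with
  | nil => simp
  | cons he hu hQ ih =>
    rw [encard_insert_of_notMem (hQ.notMem_edges he hu), ih, encard_insert_of_notMem hu]

theorem append {u v w : V} {Q R : Set E} {X Y : Set V} (h : IsGPath ends u v Q X)
    (h' : IsGPath ends v w R Y) (hXY : X ∩ Y ⊆ {v}) : IsGPath ends u w (Q ∪ R) (X ∪ Y) := by
  induction h with
  | nil => simpa [h'.left_mem] using h'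
  | @cons a b c e Q X he hu hQ ih =>
    rw [insert_union, insert_union]
    refine cons he ?_ (ih h' ((inter_subset_inter_left _ (subset_insert _ _)).trans hXY))
    rintro (haX | haY)
    · exact hu haX
    · exact hu (hXY ⟨mem_insert _ _, haY⟩ ▸ hQ.right_mem)

theorem single {u v : V} {e : E} (he : ends e = {u, v}) (huv : u ≠ v) :
    IsGPath ends u v {e} {u, v} := by
  simpa using cons he (by simpa using huv) (nil v)

theorem reverse {u w : V} {Q : Set E} {X : Set V} (h : IsGPath ends u w Q X) :
    IsGPath ends w u Q X := by
  induction h with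
  | nil v => exact nil v
  | @cons u v w e Q X he hu hQ ih =>
    have huv : v ≠ u := fun h => hu (h ▸ hQ.left_mem)
    convert ih.append (single (he.trans (pair_comm u v)) huv) ?_ using 1
    · rw [union_singleton]
    · rw [union_insert, union_singleton, insert_comm, insert_eq_of_mem hQ.left_mem]
    · rintro x ⟨hx, rfl | rfl⟩
      · rfl
      · exact absurd hx hu

/-- Two internally disjoint paths with the same endpoints form a circle. -/
theorem isCircle_union {v w : V} {Q R : Set E} {X Y : Set V} (h : IsGPath ends v w Q X)
    (h' : IsGPath ends v w R Y) (hvw : v ≠ w) (hXY : X ∩ Y = {v, w}) (hQR : Disjoint Q R) :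
    IsCircle ends (Q ∪ R) := by
  cases h with
  | nil => exact absurd rfl hvw
  | @cons _ a _ e Q X he hv hQ =>
    -- The first edge `e = va` of one path closes the path that follows `R` to `w` and returns along
    -- `Q` to `a`.
    refine ⟨v, a, R ∪ Q, Y ∪ X, e, h'.append hQ.reverse ?_, fun hva => hv (hva ▸ hQ.left_mem), he,
      ?_, by rw [insert_union, union_comm]⟩
    · rintro x ⟨hxY, hxX⟩
      have hx : x ∈ ({v, w} : Set V) := hXY ▸ ⟨mem_insert_of_mem _ hxX, hxY⟩
      rcases hx with rfl | hx
      · exact absurd hxX hv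
      · exact hx
    · rintro (heR | heQ)
      · exact disjoint_left.1 hQR (mem_insert _ _) heR
      · exact hQ.notMem_edges he hv heQ

end IsGPath

theorem EdgeJoined.symm {S : Set E} {v w : V} (h : EdgeJoined ends S v w) :
    EdgeJoined ends S w v := by
  induction h with
  | refl => exact Relation.ReflTransGen.refl
  | tail _ h ih =>
    obtain ⟨e, he, hv, hw⟩ := h
    exact Relation.ReflTransGen.head ⟨e, he, hw, hv⟩ ih

theorem EdgeJoined.mem_of_closed {S : Set E} {Y : Set V}
    (hY : ∀ e ∈ S, ∀ v ∈ ends e, ∀ w ∈ ends e, v ∈ Y → w ∈ Y) {v w : V} (hv : v ∈ Y)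
    (h : EdgeJoined ends S v w) : w ∈ Y := by
  induction h with
  | refl => exact hv
  | tail _ h ih =>
    obtain ⟨e, he, h1, h2⟩ := h
    exact hY e he _ h1 _ h2 ih

/-- A property of pairs of an edge set and a node set that holds for a single node and is kept when
a new node is attached by an edge holds for the full node set of a finite connected graph and some
set of its edges. -/
theorem ConnectedEdges.exists_of_grow (hG : IsLHGraph ends) {S : Set E}
    (hS : ConnectedEdges ends S) (hfin : (nodesOf ends S).Finite) (p : Set E → Set V → Prop)
    {v : V} (hv : v ∈ nodesOf ends S) (hp : p ∅ {v})
    (step : ∀ T Y e y x, p T Y → T ⊆ S → e ∈ S → Y ⊆ nodesOf ends S → ends e = {y, x} → y ∈ Y →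
      x ∉ Y → p (insert e T) (insert x Y)) :
    ∃ T ⊆ S, p T (nodesOf ends S) := by
  suffices h : ∀ n : ℕ, ∀ T ⊆ S, ∀ Y ⊆ nodesOf ends S, v ∈ Y → p T Y →
      (nodesOf ends S \ Y).ncard = n → ∃ T ⊆ S, p T (nodesOf ends S) from
    h _ ∅ (empty_subset _) {v} (singleton_subset_iff.2 hv) rfl hp rfl
  intro n
  induction n with
  | zero =>
    intro T hT Y hY _ hp hn
    rw [ncard_eq_zero hfin.sdiff, sdiff_eq_empty] at hn
    exact ⟨T, hT, Subset.antisymm hY hn ▸ hp⟩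
  | succ n ih =>
    intro T hT Y hY hvY hp hn
    obtain ⟨w, hw, hwY⟩ : (nodesOf ends S \ Y).Nonempty :=
      (ncard_pos hfin.sdiff).1 (hn ▸ n.succ_pos)
    obtain ⟨e, he, y, hy, x, hx, hyY, hxY⟩ : ∃ e ∈ S, ∃ y ∈ ends e, ∃ x ∈ ends e,
        y ∈ Y ∧ x ∉ Y := by
      by_contra! hcon
      exact hwY ((hS.2 v hv w hw).mem_of_closed hcon hvY)
    have hxS := ends_subset_nodesOf he hx
    refine ih (insert e T) (insert_subset he hT) (insert x Y) (insert_subset hxS hY)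
      (mem_insert_of_mem _ hvY)
      (step T Y e y x hp hT he hY (hG.eq_pair hy hx fun h => hxY (h ▸ hyY)) hyY hxY) ?_
    rw [← insert_sdiff_self_of_mem (a := x) (s := nodesOf ends S \ Y) ⟨hxS, hxY⟩,
      ncard_insert_of_notMem (by simp) (hfin.sdiff.sdiff)] at hn
    rw [← union_singleton, ← sdiff_sdiff]
    exact Nat.succ_injective hn

/-- The node sets of the components of `(N(S), S)`. -/
def graphComps (ends : E → Set V) (S : Set E) : Set (Set V) :=
  {W | ∃ v ∈ nodesOf ends S, W = {w | EdgeJoined ends S v w}}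

theorem mem_of_mem_graphComps {S : Set E} {W : Set V} (hW : W ∈ graphComps ends S) {v w : V}
    (hv : v ∈ W) (h : EdgeJoined ends S v w) : w ∈ W := by
  obtain ⟨u, hu, rfl⟩ := hW
  exact Relation.ReflTransGen.trans hv h

theorem edgeJoined_of_mem_graphComps {S : Set E} {W : Set V} (hW : W ∈ graphComps ends S)
    {v w : V} (hv : v ∈ W) (hw : w ∈ W) : EdgeJoined ends S v w := by
  obtain ⟨u, hu, rfl⟩ := hW
  exact Relation.ReflTransGen.trans (EdgeJoined.symm hv) hw

theorem ends_subset_of_mem_graphComps {S : Set E} {W : Set V} (hW : W ∈ graphComps ends S) {e : E}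
    (he : e ∈ S) {v : V} (hv : v ∈ W) (hve : v ∈ ends e) : ends e ⊆ W :=
  fun _ hw => mem_of_mem_graphComps hW hv (Relation.ReflTransGen.single ⟨e, he, hve, hw⟩)

theorem eq_of_mem_graphComps {S : Set E} {W W' : Set V} (hW : W ∈ graphComps ends S)
    (hW' : W' ∈ graphComps ends S) {v : V} (hv : v ∈ W) (hv' : v ∈ W') : W = W' := by
  ext w
  exact ⟨fun hw => mem_of_mem_graphComps hW' hv' (edgeJoined_of_mem_graphComps hW hv hw),
    fun hw => mem_of_mem_graphComps hW hv (edgeJoined_of_mem_graphComps hW' hv' hw)⟩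

theorem sUnion_graphComps (S : Set E) : ⋃₀ graphComps ends S = nodesOf ends S := by
  refine Subset.antisymm (sUnion_subset ?_) fun v hv =>
    ⟨_, ⟨v, hv, rfl⟩, Relation.ReflTransGen.refl⟩
  rintro _ ⟨v, hv, rfl⟩ w hw
  exact EdgeJoined.mem_of_closed (fun e he _ _ w hw _ => ends_subset_nodesOf he hw) hv hw

theorem subset_nodesOf_of_mem_graphComps {S : Set E} {W : Set V} (hW : W ∈ graphComps ends S) :
    W ⊆ nodesOf ends S :=
  sUnion_graphComps (ends := ends) S ▸ subset_sUnion_of_mem hW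

theorem finite_graphComps {S : Set E} (h : (nodesOf ends S).Finite) :
    (graphComps ends S).Finite :=
  (h.image fun v => {w | EdgeJoined ends S v w}).subset fun _ ⟨v, hv, hW⟩ => ⟨v, hv, hW.symm⟩

theorem nodesOf_of_mem_graphComps {S : Set E} {W : Set V} (hW : W ∈ graphComps ends S) :
    nodesOf ends {e ∈ S | ends e ⊆ W} = W := by
  ext v
  rw [mem_nodesOf]
  constructor
  · rintro ⟨e, he, hv⟩
    exact he.2 hv
  · intro hv
    obtain ⟨e, he, hve⟩ := mem_nodesOf.1 (subset_nodesOf_of_mem_graphComps hW hv)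
    exact ⟨e, ⟨he, ends_subset_of_mem_graphComps hW he hv hve⟩, hve⟩

theorem connectedEdges_of_mem_graphComps {S : Set E} {W : Set V} (hW : W ∈ graphComps ends S) :
    ConnectedEdges ends {e ∈ S | ends e ⊆ W} := by
  refine ⟨?_, ?_⟩
  · obtain ⟨v, hv, hW'⟩ := id hW
    have hvW : v ∈ W := hW' ▸ Relation.ReflTransGen.refl
    obtain ⟨e, he, hve⟩ := mem_nodesOf.1 hv
    exact ⟨e, he, ends_subset_of_mem_graphComps hW he hvW hve⟩
  · rw [nodesOf_of_mem_graphComps hW]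
    intro v hv w hw
    have h := edgeJoined_of_mem_graphComps hW hv hw
    -- A walk starting in a component never leaves it, so all its edges lie inside `W`.
    suffices w ∈ {w | w ∈ W ∧ EdgeJoined ends {e ∈ S | ends e ⊆ W} v w} from this.2
    refine h.mem_of_closed ?_ ⟨hv, Relation.ReflTransGen.refl⟩
    rintro e he a ha b hb ⟨haW, hva⟩
    have heW := ends_subset_of_mem_graphComps hW he haW ha
    exact ⟨heW hb, hva.tail ⟨e, ⟨he, heW⟩, ha, hb⟩⟩

end GraphLemmas

/-! ### Frames: codimension counts from incidences -/

namespace ProjGeom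

variable {P V E : Type*} {G : ProjGeom P}

/-- A frame: points `x v` that span the geometry, for each `v` a hyperplane `k v` that contains all
of them but `x v`, and hyperplanes `h e` that contain all of them but one or two, whose indices are
the endpoints of `e`. -/
structure IsFrame (G : ProjGeom P) (x : V → P) (k : V → Set P) (h : E → Set P)
    (ends : E → Set V) : Prop where
  span_range : G.span (range x) = univ
  isHyperplane_node : ∀ v, G.IsHyperplane (k v)
  mem_node_iff : ∀ v w, x v ∈ k w ↔ v ≠ w
  isHyperplane : ∀ e, G.IsHyperplane (h e)
  mem_iff : ∀ v e, x v ∈ h e ↔ v ∉ ends e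
  graph : IsLHGraph ends

/-- The circles whose hyperplanes intersect in a flat of smaller codimension than their length. -/
def lowCircles (G : ProjGeom P) (h : E → Set P) (ends : E → Set V) : Set (Set E) :=
  {C | IsCircle ends C ∧ G.codim (⋂ e ∈ C, h e) < C.encard}

namespace IsFrame

variable {x : V → P} {k : V → Set P} {h : E → Set P} {ends : E → Set V}

theorem codim_le_encard (F : G.IsFrame x k h ends) {X : Set V} {t : Set P} (ht : x '' Xᶜ ⊆ t) :
    G.codim t ≤ X.encard := by
  refine (codim_le (B := x '' X) (eq_univ_of_univ_subset ?_)).trans (encard_image_le x X)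
  rw [← F.span_range]
  refine span_mono ?_
  rintro _ ⟨v, rfl⟩
  by_cases hv : v ∈ X
  · exact Or.inr (mem_image_of_mem x hv)
  · exact Or.inl (ht (mem_image_of_mem x hv))

/-- If the subspace `t` has the largest possible codimension among the subspaces that contain all
frame points outside `X`, it is contained in all hyperplanes that contain these points. -/
theorem subset_of_encard_le_codim (F : G.IsFrame x k h ends) {X : Set V} (hX : X.Finite)
    {t H : Set P} (hts : G.IsSubspace t) (hH : G.IsHyperplane H) (ht : x '' Xᶜ ⊆ t)
    (htH : x '' Xᶜ ⊆ H) (hle : X.encard ≤ G.codim t) : t ⊆ H := by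
  by_contra hne
  have h1 := F.codim_le_encard (subset_inter ht htH)
  rw [codim_inter hts hH hne] at h1
  exact absurd ((add_le_add_left hle 1).trans h1)
    (not_le.2 ((ENat.lt_add_one_iff hX.encard_lt_top.ne).2 le_rfl))

theorem image_subset (F : G.IsFrame x k h ends) {X : Set V} {e : E} (he : Disjoint (ends e) X) :
    x '' X ⊆ h e := by
  rintro _ ⟨v, hv, rfl⟩
  exact (F.mem_iff v e).2 fun hve => disjoint_left.1 he hve hv

theorem image_subset_biInter (F : G.IsFrame x k h ends) {X : Set V} {S : Set E}
    (hS : ∀ e ∈ S, Disjoint (ends e) X) : x '' X ⊆ ⋂ e ∈ S, h e :=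
  subset_iInter₂ fun e he => F.image_subset (hS e he)

theorem image_subset_biInter_node (F : G.IsFrame x k h ends) {X Y : Set V} (hXY : Disjoint X Y) :
    x '' X ⊆ ⋂ v ∈ Y, k v := by
  rintro _ ⟨v, hv, rfl⟩
  exact mem_iInter₂.2 fun w hw => (F.mem_node_iff v w).2 fun hvw =>
    disjoint_left.1 hXY hv (hvw ▸ hw)

theorem isSubspace_nodes (F : G.IsFrame x k h ends) (X : Set V) :
    G.IsSubspace (⋂ v ∈ X, k v) :=
  isSubspace_biInter_hyperplanes F.isHyperplane_node X

theorem isSubspace_edges (F : G.IsFrame x k h ends) (S : Set E) :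
    G.IsSubspace (⋂ e ∈ S, h e) :=
  isSubspace_biInter_hyperplanes F.isHyperplane S

/-- Attaching a new node by an edge. -/
theorem codim_inter_insert (F : G.IsFrame x k h ends) {t : Set P} (ht : G.IsSubspace t)
    {S : Set E} {e : E} {v : V} (hv : v ∈ ends e) (hvt : x v ∈ t)
    (hvS : ∀ f ∈ S, v ∉ ends f) :
    G.codim (t ∩ ⋂ f ∈ insert e S, h f) = G.codim (t ∩ ⋂ f ∈ S, h f) + 1 := by
  rw [biInter_insert, inter_comm (h e), ← inter_assoc]
  refine codim_inter (ht.inter (F.isSubspace_edges S)) (F.isHyperplane e) fun hsub => ?_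
  exact (F.mem_iff v e).1 (hsub ⟨hvt, mem_iInter₂.2 fun f hf => (F.mem_iff v f).2 (hvS f hf)⟩) hv

/-- The path is built backwards from `w`; each edge attaches its first node, whose frame point lies
in `t`. Only `w` may already be in use. -/
theorem codim_inter_path (F : G.IsFrame x k h ends) {t : Set P} (ht : G.IsSubspace t) {v w : V}
    {Q : Set E} {X : Set V} (hQ : IsGPath ends v w Q X) (hX : ∀ u ∈ X, u ≠ w → x u ∈ t) :
    G.codim (t ∩ ⋂ f ∈ Q, h f) = G.codim t + Q.encard := by
  induction hQ with
  | nil => simp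
  | @cons u v w e Q X he hu hQ ih =>
    rw [F.codim_inter_insert ht (v := u) (by simp [he])
      (hX u (mem_insert _ _) fun huw => hu (huw ▸ hQ.right_mem))
      (fun f hf huf => hu (hQ.ends_subset f hf huf)),
      ih fun u hu => hX u (mem_insert_of_mem _ hu),
      encard_insert_of_notMem (hQ.notMem_edges he hu), add_assoc]

theorem codim_path (F : G.IsFrame x k h ends) {v w : V} {Q : Set E} {X : Set V}
    (hQ : IsGPath ends v w Q X) : G.codim (⋂ f ∈ Q, h f) = Q.encard := by
  simpa [codim_univ] using F.codim_inter_path isSubspace_univ hQ (by simp)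

theorem codim_inter_nodes (F : G.IsFrame x k h ends) {t : Set P} (ht : G.IsSubspace t) {X : Set V}
    (hX : X.Finite) (hXt : x '' X ⊆ t) :
    G.codim (t ∩ ⋂ v ∈ X, k v) = G.codim t + X.encard := by
  induction X, hX using Set.Finite.induction_on with
  | empty => simp
  | @insert a s ha hs ih =>
    rw [biInter_insert, inter_comm (k a), ← inter_assoc, codim_inter
      (ht.inter (F.isSubspace_nodes s)) (F.isHyperplane_node a),
      ih ((image_mono (subset_insert _ _)).trans hXt), encard_insert_of_notMem ha, add_assoc]
    intro hsub
    refine (F.mem_node_iff a a).1 (hsub ⟨hXt (mem_image_of_mem x (mem_insert _ _)), ?_⟩) rfl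
    exact mem_iInter₂.2 fun v hv => (F.mem_node_iff a v).2 fun hav => ha (hav ▸ hv)

theorem codim_nodes (F : G.IsFrame x k h ends) {X : Set V} (hX : X.Finite) :
    G.codim (⋂ v ∈ X, k v) = X.encard := by
  simpa [codim_univ] using F.codim_inter_nodes isSubspace_univ hX (subset_univ _)

/-- The node hyperplanes at the ends of `e` already intersect in the largest codimension allowed by
the frame points off `e`, so `h e` contains their intersection. -/
theorem biInter_nodes_subset (F : G.IsFrame x k h ends) (S : Set E) :
    (⋂ v ∈ nodesOf ends S, k v) ⊆ ⋂ e ∈ S, h e := by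
  refine subset_iInter₂ fun e he => (biInter_anti (ends_subset_nodesOf he)).trans ?_
  exact F.subset_of_encard_le_codim (F.graph.finite e) (F.isSubspace_nodes _) (F.isHyperplane e)
    (F.image_subset_biInter_node disjoint_compl_left) (F.image_subset disjoint_compl_right)
    (F.codim_nodes (F.graph.finite e)).ge

/-! ### The linear class of balanced circles -/

/-- An edge of a balanced circle is in the closure of the others, which form a path. -/
theorem biInter_subset_of_mem_lowCircles (F : G.IsFrame x k h ends) {Q : Set E} {e : E}
    (hQ : G.codim (⋂ f ∈ Q, h f) = Q.encard) (he : insert e Q ∈ G.lowCircles h ends) :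
    (⋂ f ∈ Q, h f) ⊆ h e := by
  by_contra hne
  have h1 := he.2
  rw [codim_biInter_insert F.isHyperplane hne, hQ] at h1
  exact h1.not_ge (encard_insert_le Q e)

/-- Suppose only `Q₁ ∪ Q₃` is unbalanced, hence independent. With `f` and `e` the first edges of
`Q₂` and `Q₁`, attaching `Q₂` without `f` keeps independence. But balance of `Q₂ ∪ Q₃` makes `f`
redundant, and then balance of `Q₁ ∪ Q₂` makes `e` redundant, a contradiction. -/
theorem isBiasedGraph (F : G.IsFrame x k h ends) :
    IsBiasedGraph ends (G.lowCircles h ends) where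
  graph := F.graph
  circle C hC := hC.1
  linear Q₁ Q₂ Q₃ := by
    rintro ⟨v, w, X₁, X₂, X₃, hvw, h₁, h₂, h₃, h₁₂, h₂₃, h₁₃, d₁₂, d₂₃, d₁₃⟩ ⟨hc₁₂, hc₂₃, hc₁₃⟩
    have hle : (Q₁ ∪ Q₃).encard ≤ G.codim (⋂ f ∈ Q₁ ∪ Q₃, h f) :=
      not_lt.1 fun hlt => hc₁₃ ⟨h₁.isCircle_union h₃ hvw h₁₃ d₁₃, hlt⟩
    cases h₂ with
    | nil => exact hvw rfl
    | @cons _ v₂ _ f R₂ Y₂ hf hv₂ hR₂ =>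
    cases h₁ with
    | nil => exact hvw rfl
    | @cons _ v₁ _ e R₁ Y₁ he hv₁ hR₁ =>
    have hY₂₃ : ∀ u ∈ Y₂, u ≠ w → u ∉ X₃ := fun u hu huw hu3 => by
      have : u ∈ ({v, w} : Set V) := h₂₃ ▸ ⟨mem_insert_of_mem _ hu, hu3⟩
      rcases this with rfl | h
      · exact hv₂ hu
      · exact huw h
    have hY₂₁ : ∀ u ∈ Y₂, u ≠ w → u ∉ insert v Y₁ := fun u hu huw hu1 => by
      have : u ∈ ({v, w} : Set V) := h₁₂ ▸ ⟨hu1, mem_insert_of_mem _ hu⟩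
      rcases this with rfl | h
      · exact hv₂ hu
      · exact huw h
    have hx₃ : ∀ u ∈ Y₂, u ≠ w → x u ∈ ⋂ g ∈ Q₃, h g := fun u hu huw =>
      mem_iInter₂.2 fun g hg => (F.mem_iff u g).2 fun hug =>
        hY₂₃ u hu huw (h₃.ends_subset g hg hug)
    have hx₁ : ∀ u ∈ Y₂, u ≠ w → x u ∈ ⋂ g ∈ insert e R₁, h g := fun u hu huw =>
      mem_iInter₂.2 fun g hg => (F.mem_iff u g).2 fun hug =>
        hY₂₁ u hu huw ((IsGPath.cons he hv₁ hR₁).ends_subset g hg hug)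
    have hd₂₃ : Disjoint R₂ Q₃ := d₂₃.mono_left (subset_insert _ _)
    have hd₁₂ : Disjoint R₁ (insert f R₂) := d₁₂.mono_left (subset_insert _ _)
    have hsub_f : (⋂ g ∈ R₂ ∪ Q₃, h g) ⊆ h f := by
      refine F.biInter_subset_of_mem_lowCircles ?_ (by rwa [← insert_union])
      rw [biInter_union, inter_comm, F.codim_inter_path (F.isSubspace_edges Q₃) hR₂ hx₃,
        F.codim_path h₃, encard_union_eq hd₂₃, add_comm]
    have hsub_e : (⋂ g ∈ R₁ ∪ insert f R₂, h g) ⊆ h e := by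
      refine F.biInter_subset_of_mem_lowCircles ?_ (by rwa [← insert_union])
      rw [biInter_union, inter_comm, F.codim_inter_path (F.isSubspace_edges _) hR₁,
        F.codim_path (IsGPath.cons hf hv₂ hR₂), encard_union_eq hd₁₂, add_comm]
      intro u hu huw
      refine mem_iInter₂.2 fun g hg => (F.mem_iff u g).2 fun hug => ?_
      have hu2 := (IsGPath.cons hf hv₂ hR₂).ends_subset g hg hug
      have : u ∈ ({v, w} : Set V) := h₁₂ ▸ ⟨mem_insert_of_mem _ hu, hu2⟩
      rcases this with rfl | h
      · exact hv₁ hu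
      · exact huw h
    have hcod := F.codim_inter_path (F.isSubspace_edges (insert e R₁ ∪ Q₃)) hR₂ fun u hu huw => by
      rw [biInter_union]
      exact ⟨hx₁ u hu huw, hx₃ u hu huw⟩
    have heq : (⋂ g ∈ insert e R₁ ∪ Q₃, h g) ∩ (⋂ g ∈ R₂, h g) = ⋂ g ∈ (R₁ ∪ Q₃) ∪ R₂, h g := by
      rw [← biInter_union]
      refine Subset.antisymm (biInter_anti ?_) (subset_iInter₂ fun g hg => ?_)
      · exact union_subset_union_left _ (union_subset_union_left _ (subset_insert _ _))
      by_cases hge : g = e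
      · subst hge
        refine subset_trans (subset_iInter₂ fun g' hg' => ?_) hsub_e
        by_cases hgf : g' = f
        · subst hgf
          exact (biInter_anti (by grind)).trans hsub_f
        · exact biInter_subset_of_mem (by grind)
      · exact biInter_subset_of_mem (by grind)
    have hle2 := codim_biInter_le F.isHyperplane ((R₁ ∪ Q₃) ∪ R₂)
    rw [← heq, hcod] at hle2
    have heR : e ∉ R₁ ∪ Q₃ := by
      rintro (h | h)
      · exact hR₁.notMem_edges he hv₁ h
      · exact disjoint_left.1 d₁₃ (mem_insert _ _) h
    have hfin : ((R₁ ∪ Q₃).encard + R₂.encard) ≠ ⊤ := by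
      rw [← lt_top_iff_ne_top, ENat.add_lt_top]
      exact ⟨(hR₁.finite.union h₃.finite).encard_lt_top, hR₂.finite.encard_lt_top⟩
    -- The edge `e` accounts for the surplus of 1 that contradicts the bound without `e`.
    rw [insert_union, encard_insert_of_notMem heR, ← insert_union] at hle
    refine absurd (((add_le_add_left hle _).trans hle2).trans (encard_union_le _ _)) (not_le.2 ?_)
    rw [add_right_comm]
    exact (ENat.lt_add_one_iff hfin).2 le_rfl

end IsFrame

end ProjGeom

namespace ProjGeom

variable {P V E : Type*} {G : ProjGeom P}

namespace IsFrame

variable {x : V → P} {k : V → Set P} {h : E → Set P} {ends : E → Set V}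

/-! ### Connected edge sets -/

/-- The left side has codimension 2, the maximum for a subspace containing all frame points except
`x v` and `x w`. -/
theorem inter_subset_node (F : G.IsFrame x k h ends) {e : E} {v w : V} (he : ends e = {v, w})
    (hvw : v ≠ w) : k v ∩ h e ⊆ k w := by
  have hdv : x '' ({v, w} : Set V)ᶜ ⊆ k v := by
    rintro _ ⟨u, hu, rfl⟩
    exact (F.mem_node_iff u v).2 fun h => hu (by simp [h])
  have hdw : x '' ({v, w} : Set V)ᶜ ⊆ k w := by
    rintro _ ⟨u, hu, rfl⟩
    exact (F.mem_node_iff u w).2 fun h => hu (by simp [h])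
  have hs := (F.isHyperplane_node v).isSubspace
  refine F.subset_of_encard_le_codim (toFinite {v, w}) (hs.inter (F.isHyperplane e).isSubspace)
    (F.isHyperplane_node w)
    (subset_inter hdv (F.image_subset (he ▸ disjoint_compl_right))) hdw ?_
  rw [codim_inter hs (F.isHyperplane e) fun hsub =>
    (F.mem_iff w e).1 (hsub ((F.mem_node_iff w v).2 hvw.symm)) (by simp [he])]
  have h1 := F.codim_nodes (toFinite {v})
  rw [biInter_singleton, encard_singleton] at h1
  rw [h1, encard_pair hvw]
  norm_num

theorem biInter_subset_node (F : G.IsFrame x k h ends) {S : Set E} (hS : ConnectedEdges ends S)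
    (hb : ¬ IsBalancedSet ends (G.lowCircles h ends) S) {v : V} (hv : v ∈ nodesOf ends S) :
    (⋂ e ∈ S, h e) ⊆ k v := by
  obtain ⟨u, hu, huk⟩ : ∃ u ∈ nodesOf ends S, (⋂ e ∈ S, h e) ⊆ k u := by
    rw [IsBalancedSet, not_and_or] at hb
    push Not at hb
    rcases hb with ⟨e, he, he1⟩ | ⟨C, hCS, hC, hCB⟩
    · obtain ⟨u, hu⟩ := encard_eq_one.1 he1
      refine ⟨u, mem_nodesOf.2 ⟨e, he, by simp [hu]⟩, (biInter_subset_of_mem he).trans ?_⟩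
      refine F.subset_of_encard_le_codim (toFinite {u}) (F.isHyperplane e).isSubspace
        (F.isHyperplane_node u) (F.image_subset (hu ▸ disjoint_compl_right)) ?_ ?_
      · rintro _ ⟨w, hw, rfl⟩
        exact (F.mem_node_iff w u).2 hw
      · have h1 := codim_inter (G := G) isSubspace_univ (F.isHyperplane e) fun hsub =>
          (F.mem_iff u e).1 (hsub (mem_univ _)) (by simp [hu])
        rw [univ_inter, codim_univ, zero_add] at h1
        rw [h1, encard_singleton]
    · have hle : C.encard ≤ G.codim (⋂ e ∈ C, h e) := not_lt.1 fun hlt => hCB ⟨hC, hlt⟩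
      obtain ⟨a, b, Q, X, e, hQ, hab, he, heQ, rfl⟩ := hC
      refine ⟨a, mem_nodesOf.2 ⟨e, hCS (mem_insert _ _), by simp [he]⟩,
        (biInter_anti hCS).trans ?_⟩
      have hXf : X.Finite := by
        rw [← encard_lt_top_iff, ← hQ.encard_add_one, ← encard_insert_of_notMem heQ]
        exact (hQ.finite.insert e).encard_lt_top
      refine F.subset_of_encard_le_codim hXf (F.isSubspace_edges _) (F.isHyperplane_node a)
        (F.image_subset_biInter ?_) ?_ ?_
      · rintro f (rfl | hf)
        · rw [disjoint_compl_right_iff_subset, he]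
          exact pair_subset hQ.left_mem hQ.right_mem
        · exact disjoint_compl_right_iff_subset.2 (hQ.ends_subset f hf)
      · rintro _ ⟨w, hw, rfl⟩
        exact (F.mem_node_iff w a).2 fun hwa => hw (hwa ▸ hQ.left_mem)
      -- A circle has as many edges as nodes, so an unbalanced one attains the bound for its node
      -- set.
      · rwa [encard_insert_of_notMem heQ, hQ.encard_add_one] at hle
  refine (hS.2 u hu v hv).mem_of_closed (Y := {v | (⋂ e ∈ S, h e) ⊆ k v}) ?_ huk
  intro e he a ha b hb hak
  by_cases hab : a = b
  · exact hab ▸ hak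
  · exact (subset_inter hak (biInter_subset_of_mem he)).trans
      (F.inter_subset_node (F.graph.eq_pair ha hb hab) hab)

theorem biInter_eq_of_not_isBalancedSet (F : G.IsFrame x k h ends) {S : Set E}
    (hS : ConnectedEdges ends S) (hb : ¬ IsBalancedSet ends (G.lowCircles h ends) S) :
    (⋂ e ∈ S, h e) = ⋂ v ∈ nodesOf ends S, k v :=
  Subset.antisymm (subset_iInter₂ fun _ hv => F.biInter_subset_node hS hb hv)
    (F.biInter_nodes_subset S)

/-- A spanning tree adds one for each node except the root; every other edge closes a balanced
circle with a tree path and is redundant. In the rank formula `t` is the intersection over other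
components. The `+ 1` on the left avoids subtraction in `ℕ∞`. -/
theorem codim_inter_of_isBalancedSet (F : G.IsFrame x k h ends) {t : Set P} (ht : G.IsSubspace t)
    {S : Set E} (hS : ConnectedEdges ends S) (hfin : (nodesOf ends S).Finite)
    (hSt : x '' nodesOf ends S ⊆ t) (hb : IsBalancedSet ends (G.lowCircles h ends) S) :
    G.codim (t ∩ ⋂ e ∈ S, h e) + 1 = G.codim t + (nodesOf ends S).encard := by
  obtain ⟨v, hv⟩ : (nodesOf ends S).Nonempty := by
    obtain ⟨e, he⟩ := hS.1
    exact (F.graph.nonempty e).mono (ends_subset_nodesOf he)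
  obtain ⟨T, hTS, -, hT, hpath⟩ := hS.exists_of_grow F.graph hfin
    -- The invariant of the growing tree: its edges stay in `Y`, its codimension is known, and any
    -- two nodes of `Y` are joined by a path in it.
    (fun T Y => (∀ f ∈ T, ends f ⊆ Y) ∧
      G.codim (t ∩ ⋂ e ∈ T, h e) + 1 = G.codim t + Y.encard ∧
      ∀ a ∈ Y, ∀ b ∈ Y, ∃ Q ⊆ T, ∃ X ⊆ Y, IsGPath ends a b Q X) hv
    (by
      refine ⟨by simp, by simp, ?_⟩
      rintro a rfl b rfl
      exact ⟨∅, subset_rfl, _, subset_rfl, IsGPath.nil _⟩)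
    (by
      rintro T Y e y z ⟨hTY, hcod, hpath⟩ hTS heS hYS he hy hz
      have hzy : z ≠ y := fun h => hz (h ▸ hy)
      have hzS : z ∈ nodesOf ends S := mem_nodesOf.2 ⟨e, heS, by simp [he]⟩
      refine ⟨?_, ?_, ?_⟩
      · rintro f (rfl | hf)
        · rw [he, pair_comm]
          exact insert_subset_insert (singleton_subset_iff.2 hy)
        · exact (hTY f hf).trans (subset_insert _ _)
      · rw [F.codim_inter_insert ht (v := z) (by simp [he]) (hSt (mem_image_of_mem x hzS))
          fun f hf hzf => hz (hTY f hf hzf), hcod, encard_insert_of_notMem hz, add_assoc]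
      · have hzb : ∀ b ∈ Y, ∃ Q ⊆ insert e T, ∃ X ⊆ insert z Y, IsGPath ends z b Q X := by
          intro b hb
          obtain ⟨Q, hQ, X, hX, hp⟩ := hpath y hy b hb
          exact ⟨insert e Q, insert_subset_insert hQ, insert z X, insert_subset_insert hX,
            IsGPath.cons (he.trans (pair_comm _ _)) (fun hzX => hz (hX hzX)) hp⟩
        rintro a (rfl | ha) b (rfl | hb)
        · exact ⟨∅, empty_subset _, _, by simp, IsGPath.nil _⟩
        · exact hzb b hb
        · obtain ⟨Q, hQ, X, hX, hp⟩ := hzb a ha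
          exact ⟨Q, hQ, X, hX, hp.reverse⟩
        · obtain ⟨Q, hQ, X, hX, hp⟩ := hpath a ha b hb
          exact ⟨Q, hQ.trans (subset_insert _ _), X, hX.trans (subset_insert _ _), hp⟩)
  rw [← hT]
  congr 3
  refine Subset.antisymm (biInter_anti hTS) (subset_iInter₂ fun f hf => ?_)
  by_cases hfT : f ∈ T
  · exact biInter_subset_of_mem hfT
  obtain ⟨a, b, hab, hfe⟩ := encard_eq_two.1 ((F.graph f).resolve_left (hb.1 f hf))
  obtain ⟨Q, hQ, X, hX, hp⟩ := hpath a (ends_subset_nodesOf hf (by simp [hfe])) b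
    (ends_subset_nodesOf hf (by simp [hfe]))
  refine (biInter_anti hQ).trans (F.biInter_subset_of_mem_lowCircles (F.codim_path hp) ?_)
  exact hb.2 _ (insert_subset hf (hQ.trans hTS))
    ⟨a, b, Q, X, f, hp, hab, hfe, fun hfQ => hfT (hQ hfQ), rfl⟩

theorem codim_inter_of_not_isBalancedSet (F : G.IsFrame x k h ends) {t : Set P}
    (ht : G.IsSubspace t) {S : Set E} (hS : ConnectedEdges ends S)
    (hfin : (nodesOf ends S).Finite) (hSt : x '' nodesOf ends S ⊆ t)
    (hb : ¬ IsBalancedSet ends (G.lowCircles h ends) S) :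
    G.codim (t ∩ ⋂ e ∈ S, h e) = G.codim t + (nodesOf ends S).encard := by
  rw [F.biInter_eq_of_not_isBalancedSet hS hb, F.codim_inter_nodes ht hfin hSt]

theorem biInter_mem_interFlats_nodes (F : G.IsFrame x k h ends) {S : Set E}
    (hS : ConnectedEdges ends S) (hb : ¬ IsBalancedSet ends (G.lowCircles h ends) S) :
    (⋂ e ∈ S, h e) ∈ interFlats (range k) :=
  F.biInter_eq_of_not_isBalancedSet hS hb ▸ biInter_mem_interFlats _

theorem not_isBalancedSet_iff (F : G.IsFrame x k h ends) {S : Set E}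
    (hS : ConnectedEdges ends S) (hfin : (nodesOf ends S).Finite) :
    ¬ IsBalancedSet ends (G.lowCircles h ends) S ↔ (⋂ e ∈ S, h e) ∈ interFlats (range k) := by
  refine ⟨F.biInter_mem_interFlats_nodes hS, ?_⟩
  rintro ⟨K, hK, hSK⟩ hb
  -- The point `x v` is outside the intersection, so some member of `K` misses it, and the only node
  -- hyperplane missing `x v` is `k v`. The codimension is then at least `#N(S)`, one more than
  -- balance permits.
  have hsub : (⋂ e ∈ S, h e) ⊆ ⋂ v ∈ nodesOf ends S, k v := by
    refine subset_iInter₂ fun v hv => ?_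
    obtain ⟨e, he, hve⟩ := mem_nodesOf.1 hv
    have hv' : x v ∉ ⋂ e ∈ S, h e := fun hmem =>
      (F.mem_iff v e).1 (mem_iInter₂.1 hmem e he) hve
    rw [hSK, mem_sInter] at hv'
    push Not at hv'
    obtain ⟨H, hH, hvH⟩ := hv'
    obtain ⟨w, rfl⟩ := hK hH
    rw [F.mem_node_iff, not_not] at hvH
    rw [hvH, hSK]
    exact sInter_subset_of_mem hH
  have h1 := codim_anti (G := G) hsub
  have h2 := F.codim_inter_of_isBalancedSet isSubspace_univ hS hfin (subset_univ _) hb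
  rw [univ_inter, codim_univ, zero_add] at h2
  rw [F.codim_nodes hfin, ← h2] at h1
  have hlt : G.codim (⋂ e ∈ S, h e) < ⊤ :=
    lt_of_le_of_lt (h2 ▸ le_self_add) hfin.encard_lt_top
  exact h1.not_gt ((ENat.lt_add_one_iff hlt.ne).2 le_rfl)

/-! ### The rank formula -/

/-- Induction on a set `D` of components: the intersection over those already treated contains the
frame points of the next one, so the connected counts apply relative to it. -/
theorem codim_biInter_add_encard (F : G.IsFrame x k h ends) {S : Set E} {D : Set (Set V)}
    (hD : D ⊆ graphComps ends S) (hfin : (nodesOf ends S).Finite) :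
    G.codim (⋂ e ∈ {e ∈ S | ∃ W ∈ D, ends e ⊆ W}, h e) +
      {W ∈ D | IsBalancedSet ends (G.lowCircles h ends) {e ∈ S | ends e ⊆ W}}.encard =
      (⋃₀ D).encard := by
  have hDf := (finite_graphComps hfin).subset hD
  induction D, hDf using Set.Finite.induction_on with
  | empty => simp [codim_univ]
  | @insert W D hWD _ ih =>
    have hWC := hD (mem_insert _ _)
    have hDC := (subset_insert _ _).trans hD
    have ih := ih hDC
    have hdisj : ∀ W' ∈ D, Disjoint W' W := fun W' hW' => disjoint_left.2 fun v hv' hv =>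
      hWD (eq_of_mem_graphComps hWC (hDC hW') hv hv' ▸ hW')
    have hsplit : {e ∈ S | ∃ W' ∈ insert W D, ends e ⊆ W'} =
        {e ∈ S | ∃ W' ∈ D, ends e ⊆ W'} ∪ {e ∈ S | ends e ⊆ W} := by
      ext e
      simp only [mem_insert_iff, exists_eq_or_imp, mem_union, mem_ofPred_eq]
      rw [← and_or_left, or_comm]
    have hconn := connectedEdges_of_mem_graphComps hWC
    have hnodes := nodesOf_of_mem_graphComps hWC
    have hWf : W.Finite := hfin.subset (subset_nodesOf_of_mem_graphComps hWC)
    have hsub : x '' W ⊆ ⋂ e ∈ {e ∈ S | ∃ W' ∈ D, ends e ⊆ W'}, h e :=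
      F.image_subset_biInter fun e ⟨_, W', hW', heW'⟩ => (hdisj W' hW').mono_left heW'
    have hunion : (⋃₀ insert W D).encard = W.encard + (⋃₀ D).encard := by
      rw [sUnion_insert, encard_union_eq]
      exact (disjoint_sUnion_left.2 hdisj).symm
    rw [hsplit, biInter_union, hunion, ← ih]
    by_cases hb : IsBalancedSet ends (G.lowCircles h ends) {e ∈ S | ends e ⊆ W}
    · have h1 := F.codim_inter_of_isBalancedSet (F.isSubspace_edges _) hconn (by rwa [hnodes])
        (by rwa [hnodes]) hb
      have h2 : {W' ∈ insert W D |
          IsBalancedSet ends (G.lowCircles h ends) {e ∈ S | ends e ⊆ W'}} = insert W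
          {W' ∈ D | IsBalancedSet ends (G.lowCircles h ends) {e ∈ S | ends e ⊆ W'}} := by
        ext W'
        simp only [mem_insert_iff, mem_ofPred_eq]
        constructor
        · tauto
        · rintro (rfl | h)
          · exact ⟨Or.inl rfl, hb⟩
          · exact ⟨Or.inr h.1, h.2⟩
      rw [h2, encard_insert_of_notMem fun h => hWD h.1, add_comm _ (1 : ℕ∞), ← add_assoc, h1,
        hnodes]
      ring
    · have h1 := F.codim_inter_of_not_isBalancedSet (F.isSubspace_edges _) hconn (by rwa [hnodes])
        (by rwa [hnodes]) hb
      have h2 : {W' ∈ insert W D |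
          IsBalancedSet ends (G.lowCircles h ends) {e ∈ S | ends e ⊆ W'}} =
          {W' ∈ D | IsBalancedSet ends (G.lowCircles h ends) {e ∈ S | ends e ⊆ W'}} := by
        ext W'
        simp only [mem_insert_iff, mem_ofPred_eq]
        constructor
        · rintro ⟨rfl | h, h'⟩
          · exact absurd h' hb
          · exact ⟨h, h'⟩
        · exact fun h => ⟨Or.inr h.1, h.2⟩
      rw [h2, h1, hnodes]
      ring

theorem isFrameMatroid (F : G.IsFrame x k h ends) :
    IsFrameMatroid ends (G.lowCircles h ends) (G.hypMatroid h F.isHyperplane) where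
  ground := rfl
  finitary := inferInstance
  rank S hS := by
    have h1 := F.codim_biInter_add_encard (S := S) subset_rfl hS
    have h2 : {e ∈ S | ∃ W ∈ graphComps ends S, ends e ⊆ W} = S := by
      refine Subset.antisymm (fun e he => he.1) fun e he => ⟨he, ?_⟩
      obtain ⟨v, hv⟩ := F.graph.nonempty e
      have hW : {w | EdgeJoined ends S v w} ∈ graphComps ends S :=
        ⟨v, ends_subset_nodesOf he hv, rfl⟩
      exact ⟨_, hW, ends_subset_of_mem_graphComps hW he Relation.ReflTransGen.refl hv⟩
    rwa [h2, sUnion_graphComps, ← codim_biInter_eq_eRk F.isHyperplane] at h1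

end IsFrame

/-! ### Cevian arrangements -/

/-- The endpoints of an edge are exactly the basis points off its hyperplane, so they do not depend
on the chosen description of it by an apex. -/
theorem IsBasis.isFrame {N : Set P} (hN : G.IsBasis N) {vhat : V → P}
    (hv : Function.Injective vhat) (hvN : range vhat = N) {h : E → Set P}
    (hh : range h ⊆ G.apicalHyps N) :
    G.IsFrame vhat (fun v => G.nodeHyp N (vhat v)) h (G.cevEnds N vhat h) := by
  have hmem : ∀ v, vhat v ∈ N := fun v => hvN ▸ mem_range_self v
  have hex : ∀ p ∈ N, ∃ v, vhat v = p := fun p hp => by rwa [← hvN] at hp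
  have hnode : ∀ v w, vhat v ∈ G.nodeHyp N (vhat w) ↔ v ≠ w := fun v w => by
    rw [hN.mem_nodeHyp_iff (hmem v), hv.ne_iff]
  have hiff : ∀ v e, vhat v ∈ h e ↔ v ∉ G.cevEnds N vhat h e := by
    intro v e
    rw [← not_iff_not, not_not]
    constructor
    · intro hve
      rcases hh (mem_range_self e) with ⟨p, hp, he⟩ | ⟨p, hp, q, hq, a, ha, haN, he⟩
      · obtain ⟨u, rfl⟩ := hex p hp
        rw [he, hnode, not_not] at hve
        exact Or.inl (hve ▸ he)
      · obtain ⟨u, rfl⟩ := hex p hp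
        obtain ⟨w, rfl⟩ := hex q hq
        rw [he, hN.mem_linkHyp_iff hp hq ha haN (hmem v), not_and_or, not_not, not_not,
          hv.eq_iff, hv.eq_iff] at hve
        rcases hve with rfl | rfl
        · exact Or.inr ⟨w, a, ha, haN, he⟩
        · exact Or.inr ⟨u, a, ha.symm, haN, he.trans (linkHyp_comm _ _ _ _)⟩
    · rintro (he | ⟨w, a, ha, haN, he⟩)
      · rw [he]
        exact hN.notMem_nodeHyp (hmem v)
      · rw [he]
        exact hN.notMem_linkHyp (hmem v) (hmem w) ha haN
  refine ⟨hvN ▸ hN.span_eq, fun v => hN.isHyperplane_nodeHyp (hmem v), hnode, fun e => ?_, hiff,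
    fun e => ?_⟩
  · rcases hh (mem_range_self e) with ⟨p, hp, he⟩ | ⟨p, hp, q, hq, a, ha, haN, he⟩
    · exact he ▸ hN.isHyperplane_nodeHyp hp
    · exact he ▸ hN.isHyperplane_linkHyp hp hq ha haN
  · have hends : G.cevEnds N vhat h e = {v | vhat v ∉ h e} := by
      ext v
      rw [mem_ofPred_eq, hiff, not_not]
    rw [hends]
    rcases hh (mem_range_self e) with ⟨p, hp, he⟩ | ⟨p, hp, q, hq, a, ha, haN, he⟩
    · obtain ⟨u, rfl⟩ := hex p hp
      refine Or.inl (encard_eq_one.2 ⟨u, ?_⟩)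
      ext v
      simp [he, hnode]
    · obtain ⟨u, rfl⟩ := hex p hp
      obtain ⟨w, rfl⟩ := hex q hq
      refine Or.inr (encard_eq_two.2 ⟨u, w, fun huw => ha.1 (huw ▸ rfl), ?_⟩)
      ext v
      rw [mem_ofPred_eq, he, hN.mem_linkHyp_iff hp hq ha haN (hmem v), not_and_or, not_not,
        not_not, hv.eq_iff, hv.eq_iff]
      rfl

end ProjGeom

theorem theoremT {P V E : Type*} (G : ProjGeom P) (N : Set P) (hN : G.IsBasis N)
    (A : Set (Set P)) (hA : A ⊆ G.apicalHyps N)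
    (vhat : V → P) (hv : Function.Injective vhat) (hvN : Set.range vhat = N)
    (h : E → Set P) (hh : Function.Injective h) (hhA : Set.range h = A) :
    IsBiasedGraph (G.cevEnds N vhat h) (G.cevBal N vhat h) ∧
    ∃ (M : Matroid E) (MA : Matroid (Set P)),
      IsFrameMatroid (G.cevEnds N vhat h) (G.cevBal N vhat h) M ∧
      G.IsHypMatroid A MA ∧
      M.map h hh.injOn = MA ∧
      -- intersection flats and closed sets
      (∀ t ∈ interFlats A, M.IsFlat (cevEdges h t) ∧ M.eRk (cevEdges h t) = G.codim t) ∧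
      (∀ t ∈ interFlats A, ∀ t' ∈ interFlats A, cevEdges h t ⊆ cevEdges h t' ↔ t' ⊆ t) ∧
      Set.BijOn (cevEdges h) {t ∈ interFlats A | G.codim t < ⊤}
        {F | M.IsFlat F ∧ M.eRk F < ⊤} ∧
      (N.Finite → Set.BijOn (cevEdges h) (interFlats A) {F | M.IsFlat F}) ∧
      -- connected edge sets
      (∀ S : Set E, ConnectedEdges (G.cevEnds N vhat h) S →
        ¬ IsBalancedSet (G.cevEnds N vhat h) (G.cevBal N vhat h) S →
        (⋂ e ∈ S, h e) ∈ interFlats (G.nodeHyp N '' N)) ∧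
      (∀ S : Set E, ConnectedEdges (G.cevEnds N vhat h) S →
        (nodesOf (G.cevEnds N vhat h) S).Finite →
        (¬ IsBalancedSet (G.cevEnds N vhat h) (G.cevBal N vhat h) S ↔
          (⋂ e ∈ S, h e) ∈ interFlats (G.nodeHyp N '' N))) := by
  subst hhA
  have F := hN.isFrame hv hvN hA
  have hk : G.nodeHyp N '' N = range fun v => G.nodeHyp N (vhat v) := by
    rw [← hvN, ← range_comp]
    rfl
  -- For this frame `lowCircles` is `cevBal` by definition, and the frame matroid is the hyperplane
  -- matroid itself, indexed by the edges.
  refine ⟨F.isBiasedGraph, G.hypMatroid h F.isHyperplane, _, F.isFrameMatroid,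
    ProjGeom.isHypMatroid_map F.isHyperplane hh, rfl,
    fun t ht => ⟨ProjGeom.isFlat_cevEdges F.isHyperplane ht,
      ProjGeom.eRk_cevEdges F.isHyperplane ht⟩,
    fun t ht t' _ => ProjGeom.cevEdges_subset_iff ht, ProjGeom.bijOn_cevEdges F.isHyperplane,
    ProjGeom.bijOn_cevEdges_of_finite F.isHyperplane hN.span_eq,
    fun S hS hb => hk ▸ F.biInter_mem_interFlats_nodes hS hb,
    fun S hS hfin => hk ▸ F.not_isBalancedSet_iff hS hfin⟩
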